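/- For each $n\ge 2$ let $\|X_{nij}\|_{1\le i,j\le n}$ be a matrix of independent real random variables, all of whose moments are finite, such that $$\sum_{i=1}^n \mathbf{E}X_{nij}=0\ \text{ for every } j,\qquad \sum_{j=1}^n \mathbf{E}X_{nij}=0\ \text{ for every } i,$$ and let $\pi_n$ be a random permutation of $1,\dots,n$ which is uniformly distributed on the set of all permutations and independent of the matrix $\|X_{nij}\|$. Put $$S_n=\sum_{i=1}^n X_{n\,i\,\pi_n(i)},\qquad B_n=\frac1n\sum_{i,j=1}^n\mathbf{E}X_{nij}^2 .$$ Let $\{M_n\}_{n\ge 2}$ be a non-decreasing sequence of positive numbers and let $D>0$ be a constant (not depending on $n,i,j,k,s$) such that for $s=1,2,3$ $$\left|\mathbf{E}X_{nij}^k\right|\le D\,k!\,M_n^{k-s}\,\mathbf{E}|X_{nij}|^s$$ for all integers $k\ge s$, all $1\le i,j\le n$ and all $n\ge 2$. Put $$\gamma_n=\max\left\{\max_{i,j}\frac{\sqrt n}{\sqrt{B_n}}\mathbf{E}|X_{nij}|,\ \max_i\sum_{j=1}^n\frac{\mathbf{E}X_{nij}^2}{B_n},\ \max_j\sum_{i=1}^n\frac{\mathbf{E}X_{nij}^2}{B_n},\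 \sum_{i,j=1}^n\frac{\mathbf{E}|X_{nij}|^3}{\sqrt n\,B_n^{3/2}}\right\}.$$ Then for every sequence of positive numbers $\{u_n\}$ with $u_n\to\infty$, $u_n^3=o(\sqrt n/\gamma_n)$ and $u_n=o(\sqrt{B_n}/M_n)$ as $n\to\infty$, $$\mathbf{P}\left(S_n\ge u_n\sqrt{B_n}\right)\sim 1-\Phi(u_n)\qquad\text{as } n\to\infty,$$ where $\Phi$ is the standard normal distribution function. -/

import Mathlib

open MeasureTheory ProbabilityTheory Filter Asymptotics
open scoped Nat ENNReal

/-- The finite set of permutations of `Fin n` carries its discrete σ-algebra. -/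
instance permMeasurableSpace (n : ℕ) : MeasurableSpace (Equiv.Perm (Fin n)) := ⊤

/-- `π` is a random permutation with the uniform distribution on all permutations of `Fin n`. -/
def IsUniformPerm {Ω : Type*} [MeasurableSpace Ω] {n : ℕ} (π : Ω → Equiv.Perm (Fin n))
    (μ : Measure Ω) : Prop :=
  Measurable π ∧ ∀ σ : Equiv.Perm (Fin n), μ (π ⁻¹' {σ}) = ((n ! : ℕ) : ℝ≥0∞)⁻¹

/-- The combinatorial sum `∑ i, X i (π i)`. -/
def combSum {Ω : Type*} {n : ℕ} (X : Fin n → Fin n → Ω → ℝ) (π : Ω → Equiv.Perm (Fin n))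
    (ω : Ω) : ℝ :=
  ∑ i, X i (π ω i) ω

/-- `B = (1 / n) ∑ i j, E (X i j) ^ 2`. -/
noncomputable def normB {Ω : Type*} [MeasurableSpace Ω] {n : ℕ} (X : Fin n → Fin n → Ω → ℝ)
    (μ : Measure Ω) : ℝ :=
  (1 / (n : ℝ)) * ∑ i, ∑ j, ∫ ω, X i j ω ^ 2 ∂μ

/-- The Lyapunov-type ratio: the maximum of `max_{i,j} (√n / √B) E|X i j|`,
`max_i ∑ j, E (X i j)^2 / B`, `max_j ∑ i, E (X i j)^2 / B` and
`∑ i j, E|X i j|^3 / (√n B^(3/2))`. -/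
noncomputable def lyapGamma {Ω : Type*} [MeasurableSpace Ω] {n : ℕ}
    (X : Fin n → Fin n → Ω → ℝ) (μ : Measure Ω) : ℝ :=
  max (⨆ p : Fin n × Fin n, √(n : ℝ) / √(normB X μ) * ∫ ω, |X p.1 p.2 ω| ∂μ)
    (max (⨆ i : Fin n, ∑ j, (∫ ω, X i j ω ^ 2 ∂μ) / normB X μ)
      (max (⨆ j : Fin n, ∑ i, (∫ ω, X i j ω ^ 2 ∂μ) / normB X μ)
        (∑ i, ∑ j, (∫ ω, |X i j ω| ^ 3 ∂μ) / (√(n : ℝ) * normB X μ ^ (3 / 2 : ℝ)))))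

/-! Conditioning on the permutation shows that `E exp (z S)` is `1 / n!` times the permanent of the
matrix of entrywise transforms `E exp (z X i j)`. On the relevant scale this matrix is a
perturbation `1 + a i j` of the all-ones matrix, and the double centring makes the row and column
sums of `a` much smaller than their absolute sums. Such a permanent is `n! exp (T / n) (1 + o(1))`
with `T = ∑ a i j` (`norm_sum_perm_prod_sub_le`): along `1 + w a` its derivative is the sum of the
`a i j` times minors, and each minor is nearly the permanent divided by `n`, so the logarithmic
derivative is nearly `T / n`. Taylor expansion gives `T / n = z² / 2 + o(1)`. Hence the normalised
sum `W` satisfies `E exp (z W) = exp (z² / 2) (1 + o(1))` uniformly over complex `‖z‖ ≤ K = C u`,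
for each constant `C`, with an error governed by `q = K³ γ / √n`
(`IsBernsteinArray.norm_integral_cexp_combSum_sub_le`).

For the tail, let `Q` be the law of `W` with density `exp (u w - u² / 2)`, viewed in the variable `v
= u (w - u)`. Then `P (W ≥ u) = exp (-u² / 2) ∫_{v ≥ 0} exp (-v) dQ`. The estimate above says that
the Fourier transform of `Q` is close to `exp (-(θ u)² / 2)` for bounded `θ`, so `u Q` looks locally
like a multiple of Lebesgue measure. Weighting `Q` by `smootherHat`, a positive function with
compactly supported Fourier transform, makes bounded `θ` suffice, and Lévy's continuity theorem
applies.

The outcome (`exists_tendsto_mul_exp_mul_tail`) is `u exp (u² / 2) P (W ≥ u) → c` with a universal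
`c > 0`. The standard Gaussian law satisfies the same hypothesis exactly, so dividing the two limits
proves the theorem without computing `c`. -/

/-- The permanent of the submatrix of `b` with rows `I` and columns `J`. -/
def subPerm {ι κ : Type*} [DecidableEq ι] [DecidableEq κ] (b : ι → κ → ℂ) (I : Finset ι)
    (J : Finset κ) : ℂ :=
  ∑ e : (I ≃ J), ∏ i : I, b i (e i)

/-! ### Permanents of submatrices and their expansions along rows and columns. -/

section SubPerm

variable {ι κ : Type*} [DecidableEq ι] [DecidableEq κ]

/-- Bijections `I ≃ J` sending `i` to `j` are bijections of the complements of `i` and `j`. -/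
def eraseEquiv {I : Finset ι} {J : Finset κ} (i : I) (j : J) :
    {e : I ≃ J // e i = j} ≃ (I.erase i ≃ J.erase j) where
  toFun e :=
    { toFun := fun x => ⟨e.1 ⟨x, Finset.mem_of_mem_erase x.2⟩, Finset.mem_erase.2 ⟨fun h =>
        Finset.ne_of_mem_erase x.2 (by
          have h2 : e.1 ⟨x, Finset.mem_of_mem_erase x.2⟩ = e.1 i := by rw [e.2]; exact Subtype.ext h
          exact congrArg Subtype.val (e.1.injective h2)), (e.1 _).2⟩⟩
      invFun := fun y => ⟨e.1.symm ⟨y, Finset.mem_of_mem_erase y.2⟩, Finset.mem_erase.2 ⟨fun h =>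
        Finset.ne_of_mem_erase y.2 (by
          have h2 : e.1.symm ⟨y, Finset.mem_of_mem_erase y.2⟩ = i := Subtype.ext h
          rw [Equiv.symm_apply_eq, e.2] at h2
          exact congrArg Subtype.val h2), (e.1.symm _).2⟩⟩
      left_inv := fun x => by simp
      right_inv := fun y => by simp }
  invFun e :=
    ⟨{ toFun := fun x => if h : (x : ι) = i then j else
          ⟨e ⟨x, Finset.mem_erase.2 ⟨h, x.2⟩⟩, Finset.mem_of_mem_erase (e _).2⟩
       invFun := fun y => if h : (y : κ) = j then i else
          ⟨e.symm ⟨y, Finset.mem_erase.2 ⟨h, y.2⟩⟩, Finset.mem_of_mem_erase (e.symm _).2⟩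
       left_inv := fun x => by
          by_cases h : (x : ι) = i
          · simp [h]; exact Subtype.ext h.symm
          · have := Finset.ne_of_mem_erase (e ⟨x, Finset.mem_erase.2 ⟨h, x.2⟩⟩).2
            simp [h, this]
       right_inv := fun y => by
          by_cases h : (y : κ) = j
          · simp [h]; exact Subtype.ext h.symm
          · have := Finset.ne_of_mem_erase (e.symm ⟨y, Finset.mem_erase.2 ⟨h, y.2⟩⟩).2
            simp [h, this] }, by simp⟩
  left_inv := fun e => by
    apply Subtype.ext; apply Equiv.ext; intro x
    by_cases h : (x : ι) = i
    · have : x = i := Subtype.ext h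
      subst this; simp [e.2]
    · have h' : x ≠ i := fun hx => h (congrArg Subtype.val hx)
      simp [h']
  right_inv := fun e => by
    apply Equiv.ext; intro x
    have := Finset.ne_of_mem_erase x.2
    have h' : (⟨x, Finset.mem_of_mem_erase x.2⟩ : I) ≠ i :=
      fun hx => this (congrArg Subtype.val hx)
    apply Subtype.ext
    simp [h']

lemma sum_mul_prod_erase_eq (b : ι → κ → ℂ) (c : κ → ℂ) {I : Finset ι} (J : Finset κ)
    (i : I) :
    ∑ e : (I ≃ J), c (e i) * ∏ x ∈ Finset.univ.erase i, b x (e x)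
      = ∑ j ∈ J, c j * subPerm b (I.erase i) (J.erase j) := by
  rw [← Finset.sum_fiberwise (s := Finset.univ) (g := fun e : (I ≃ J) => e i), ← Finset.sum_coe_sort J]
  refine Finset.sum_congr rfl fun j _ => ?_
  rw [Finset.sum_filter, ← Finset.sum_filter]
  rw [← Finset.sum_subtype_eq_sum_filter]
  simp only [Finset.subtype_univ]
  rw [subPerm, Finset.mul_sum]
  refine Fintype.sum_equiv (eraseEquiv i j) _ _ fun e => ?_
  rw [e.2]
  congr 1
  refine Finset.prod_bij' (fun x hx => ⟨x, Finset.mem_erase.2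
      ⟨fun h => (Finset.mem_erase.1 hx).1 (Subtype.ext h), x.2⟩⟩)
    (fun x _ => ⟨x, Finset.mem_of_mem_erase x.2⟩) ?_ ?_ ?_ ?_ ?_
  · intros; simp
  · intro x _
    have := Finset.ne_of_mem_erase x.2
    simp [Subtype.ext_iff, this]
  · intros; rfl
  · intros; rfl
  · intros; rfl

lemma subPerm_row (b : ι → κ → ℂ) {I : Finset ι} (J : Finset κ) {i : ι} (hi : i ∈ I) :
    subPerm b I J = ∑ j ∈ J, b i j * subPerm b (I.erase i) (J.erase j) := by
  rw [← sum_mul_prod_erase_eq b (b i) J ⟨i, hi⟩, subPerm]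
  refine Finset.sum_congr rfl fun e _ => ?_
  exact (Finset.mul_prod_erase Finset.univ (fun x : I => b x (e x)) (Finset.mem_univ ⟨i, hi⟩)).symm

lemma subPerm_swap (b : ι → κ → ℂ) (I : Finset ι) (J : Finset κ) :
    subPerm (fun j i => b i j) J I = subPerm b I J := by
  rw [subPerm, subPerm]
  refine Fintype.sum_equiv ⟨Equiv.symm, Equiv.symm, fun _ => rfl, fun _ => rfl⟩ _ _ fun e => ?_
  exact Fintype.prod_equiv e _ _ fun x => by simp

lemma subPerm_col (b : ι → κ → ℂ) (I : Finset ι) {J : Finset κ} {j : κ} (hj : j ∈ J) :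
    subPerm b I J = ∑ i ∈ I, b i j * subPerm b (I.erase i) (J.erase j) := by
  rw [← subPerm_swap, subPerm_row _ _ hj]
  simp only [subPerm_swap]

end SubPerm

/-! ### Crude comparison of neighbouring minors when all entries are close to one. -/

section Ratio

variable {ι : Type*} [DecidableEq ι]

/-- In the expansion along row `i` every coefficient is close to `1` and every minor is close to the
reference minor, so the `J.card` terms cannot cancel. -/
lemma norm_subPerm_ge {b : ι → ι → ℂ} {I J : Finset ι} {δ η : ℝ} (hδ : 0 ≤ δ)
    (hsmall : δ + η + δ * η ≤ 1 / 2) (hb : ∀ i j, ‖b i j - 1‖ ≤ δ) {i l₀ : ι} (hi : i ∈ I)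
    (h : ∀ l ∈ J, ‖subPerm b (I.erase i) (J.erase l) - subPerm b (I.erase i) (J.erase l₀)‖ ≤
      η * ‖subPerm b (I.erase i) (J.erase l₀)‖) :
    (J.card : ℝ) / 2 * ‖subPerm b (I.erase i) (J.erase l₀)‖ ≤ ‖subPerm b I J‖ := by
  set p := subPerm b (I.erase i) (J.erase l₀) with hp
  have h1 : ‖subPerm b I J - J.card * p‖ ≤ J.card * (1 / 2 * ‖p‖) := by
    rw [subPerm_row b J hi, ← nsmul_eq_mul, ← Finset.sum_const, ← Finset.sum_sub_distrib]
    refine (norm_sum_le_of_le (f := _) _ (fun l hl => ?_)).trans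
      (by rw [Finset.sum_const, nsmul_eq_mul])
    set q := subPerm b (I.erase i) (J.erase l)
    have e : b i l * q - p = (b i l - 1) * p + (b i l - 1) * (q - p) + (q - p) := by ring
    rw [e]
    refine (norm_add₃_le).trans ?_
    rw [norm_mul, norm_mul]
    have h2 := h l hl
    have h3 := hb i l
    have : ‖b i l - 1‖ * ‖q - p‖ ≤ δ * (η * ‖p‖) := by gcongr
    have : ‖b i l - 1‖ * ‖p‖ ≤ δ * ‖p‖ := by gcongr
    nlinarith [norm_nonneg p]
  have h2 : ‖(J.card : ℂ) * p‖ = J.card * ‖p‖ := by simp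
  have h3 := norm_sub_norm_le ((J.card : ℂ) * p) (subPerm b I J)
  rw [norm_sub_rev, h2] at h3
  linarith

/-- The two submatrices differ in one row only; expanding each along that row produces the same
minors with coefficients `b i l` and `b i' l`. Replacing the minors by one reference minor leaves
the signed sum `r`; the correction sees the absolute sum `α`, but with the extra factor `η`. The
factor `2 / J.card` comes from `norm_subPerm_ge`. Feeding in a better `η` yields a better
conclusion, so the lemma can be iterated. -/
lemma norm_subPerm_sub_le {b : ι → ι → ℂ} {I J : Finset ι} {δ η r α : ℝ} (hδ : 0 ≤ δ)
    (hη : 0 ≤ η) (hsmall : δ + η + δ * η ≤ 1 / 2) (hb : ∀ i j, ‖b i j - 1‖ ≤ δ) {i i' : ι}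
    (hi : i ∈ I) (hi' : i' ∈ I) (hne : i ≠ i') (hJ : J.Nonempty)
    (h : ∀ l ∈ J, ∀ l' ∈ J, ‖subPerm b ((I.erase i).erase i') (J.erase l) -
      subPerm b ((I.erase i).erase i') (J.erase l')‖ ≤
      η * ‖subPerm b ((I.erase i).erase i') (J.erase l')‖)
    (hr : ‖∑ l ∈ J, (b i l - b i' l)‖ ≤ r) (hα : ∑ l ∈ J, ‖b i l - b i' l‖ ≤ α) :
    ‖subPerm b (I.erase i') J - subPerm b (I.erase i) J‖ ≤
      (r + α * η) * (2 / J.card) * ‖subPerm b (I.erase i) J‖ := by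
  obtain ⟨l₀, hl₀⟩ := hJ
  have hi'' : i' ∈ I.erase i := Finset.mem_erase.2 ⟨hne.symm, hi'⟩
  have hi2 : i ∈ I.erase i' := Finset.mem_erase.2 ⟨hne, hi⟩
  have hlow := norm_subPerm_ge hδ hsmall hb (J := J) hi'' (fun l hl => h l hl l₀ hl₀)
  have hcard : (0 : ℝ) < J.card := by exact_mod_cast Finset.card_pos.2 ⟨l₀, hl₀⟩
  set p := subPerm b ((I.erase i).erase i') (J.erase l₀) with hp
  have hr0 : 0 ≤ r := (norm_nonneg _).trans hr
  have hα0 : 0 ≤ α := (Finset.sum_nonneg fun _ _ => norm_nonneg _).trans hα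
  have hdiff : ‖subPerm b (I.erase i') J - subPerm b (I.erase i) J‖ ≤ (r + α * η) * ‖p‖ := by
    rw [subPerm_row b J hi'', subPerm_row b J hi2, Finset.erase_right_comm,
      ← Finset.sum_sub_distrib]
    have e : ∀ l ∈ J, b i l * subPerm b ((I.erase i).erase i') (J.erase l) -
        b i' l * subPerm b ((I.erase i).erase i') (J.erase l) =
        (b i l - b i' l) * p +
        (b i l - b i' l) * (subPerm b ((I.erase i).erase i') (J.erase l) - p) := by
      intro l _; ring
    rw [Finset.sum_congr rfl e, Finset.sum_add_distrib, ← Finset.sum_mul, add_mul]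
    refine (norm_add_le _ _).trans (add_le_add ?_ ?_)
    · rw [norm_mul]; gcongr
    · calc _ ≤ ∑ l ∈ J, ‖b i l - b i' l‖ * (η * ‖p‖) := by
            refine norm_sum_le_of_le _ fun l hl => ?_
            rw [norm_mul]; gcongr; exact h l hl l₀ hl₀
        _ ≤ _ := by rw [← Finset.sum_mul, mul_assoc]; gcongr
  calc _ ≤ (r + α * η) * ‖p‖ := hdiff
    _ = (r + α * η) * (2 / J.card) * (J.card / 2 * ‖p‖) := by field_simp
    _ ≤ _ := by gcongr

/-- Induction on the size. The minors must be compared under deletion of two different columns,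
which is the same statement for the transpose; this is why `b` is quantified inside the induction.
-/
lemma norm_subPerm_erase_sub_le_of_card {δ : ℝ} (hδ : 0 ≤ δ) (hδ' : δ ≤ 1 / 20) (m : ℕ) :
    ∀ (b : ι → ι → ℂ) (_ : ∀ i j, ‖b i j - 1‖ ≤ δ) (I J : Finset ι) (_ : J.card = m)
      (_ : I.card = m + 1), ∀ i ∈ I, ∀ i' ∈ I,
      ‖subPerm b (I.erase i') J - subPerm b (I.erase i) J‖ ≤
        8 * δ * ‖subPerm b (I.erase i) J‖ := by
  induction m with
  | zero =>
    intro b hb I J hJ hI i hi i' hi'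
    obtain ⟨x, rfl⟩ := Finset.card_eq_one.1 hI
    rw [Finset.mem_singleton] at hi hi'
    subst hi; subst hi'
    simp; positivity
  | succ m ih =>
    intro b hb I J hJ hI i hi i' hi'
    rcases eq_or_ne i i' with rfl | hne
    · simp; positivity
    have hcard : (0 : ℝ) < J.card := by rw [hJ]; positivity
    have hd : ∀ l, ‖b i l - b i' l‖ ≤ 2 * δ := fun l => by
      have := norm_sub_le (b i l - 1) (b i' l - 1)
      rw [sub_sub_sub_cancel_right] at this
      linarith [hb i l, hb i' l]
    have hs : ∑ l ∈ J, ‖b i l - b i' l‖ ≤ J.card * (2 * δ) := by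
      refine (Finset.sum_le_card_nsmul _ _ _ (fun l _ => hd l)).trans (by simp)
    have key := norm_subPerm_sub_le (b := b) (J := J) (η := 8 * δ) hδ (by positivity)
      (by nlinarith) hb hi hi' hne (Finset.card_pos.1 (by omega)) ?_
      ((norm_sum_le _ _).trans hs) hs
    · refine key.trans ?_
      refine mul_le_mul_of_nonneg_right ?_ (norm_nonneg _)
      -- The constant `8` reproduces itself: `4 δ (1 + 8 δ) ≤ 8 δ` because `δ ≤ 1 / 20`.
      rw [show (J.card * (2 * δ) + J.card * (2 * δ) * (8 * δ)) * (2 / (J.card : ℝ)) =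
        4 * δ * (1 + 8 * δ) by field_simp; ring]
      nlinarith
    · intro l hl l' hl'
      have := ih (fun j i => b i j) (fun _ _ => hb _ _) J ((I.erase i).erase i')
        (by rw [Finset.card_erase_of_mem (Finset.mem_erase.2 ⟨hne.symm, hi'⟩),
          Finset.card_erase_of_mem hi]; omega) hJ l' hl' l hl
      rwa [subPerm_swap b, subPerm_swap b] at this

end Ratio

/-! ### Refined comparison using small row and column sums, and the permanent near the all-ones
matrix. -/

section RefinedRatio

variable {ι : Type*} [Fintype ι]

lemma norm_sum_sub_le_of_card_compl [DecidableEq ι] {f g : ι → ℂ} {δ ρ : ℝ} {k : ℕ} (J : Finset ι)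
    (hf : ∀ l, ‖f l - 1‖ ≤ δ) (hg : ∀ l, ‖g l - 1‖ ≤ δ) (hfs : ‖∑ l, (f l - 1)‖ ≤ ρ)
    (hgs : ‖∑ l, (g l - 1)‖ ≤ ρ) (hJ : Jᶜ.card = k) :
    ‖∑ l ∈ J, (f l - g l)‖ ≤ 2 * ρ + 2 * k * δ := by
  have key : ∀ h : ι → ℂ, (∀ l, ‖h l - 1‖ ≤ δ) → ‖∑ l, (h l - 1)‖ ≤ ρ →
      ‖∑ l ∈ J, (h l - 1)‖ ≤ ρ + k * δ := by
    intro h h1 h2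
    have e : ∑ l ∈ J, (h l - 1) = ∑ l, (h l - 1) - ∑ l ∈ Jᶜ, (h l - 1) := by
      rw [← Finset.sum_add_sum_compl J]; ring
    rw [e]
    refine (norm_sub_le _ _).trans (add_le_add h2 ?_)
    refine (norm_sum_le_of_le _ fun l _ => h1 l).trans ?_
    rw [Finset.sum_const, hJ, nsmul_eq_mul]
  have e : ∑ l ∈ J, (f l - g l) = ∑ l ∈ J, (f l - 1) - ∑ l ∈ J, (g l - 1) := by
    rw [← Finset.sum_sub_distrib]; simp
  rw [e]
  refine (norm_sub_le _ _).trans ?_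
  linarith [key f hf hfs, key g hg hgs]

lemma sum_norm_sub_le_of_sum_norm_sub_one_le {f g : ι → ℂ} {A : ℝ} (J : Finset ι)
    (hf : ∑ l, ‖f l - 1‖ ≤ A) (hg : ∑ l, ‖g l - 1‖ ≤ A) :
    ∑ l ∈ J, ‖f l - g l‖ ≤ 2 * A := by
  calc ∑ l ∈ J, ‖f l - g l‖ ≤ ∑ l, ‖f l - g l‖ :=
        Finset.sum_le_univ_sum_of_nonneg fun _ => norm_nonneg _
    _ ≤ ∑ l, (‖f l - 1‖ + ‖g l - 1‖) := by
        refine Finset.sum_le_sum fun l _ => ?_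
        have := norm_sub_le (f l - 1) (g l - 1)
        rwa [sub_sub_sub_cancel_right] at this
    _ ≤ 2 * A := by rw [Finset.sum_add_distrib]; linarith

/-- Entries close to one, with small row and column sums of the deviations. -/
structure IsNearOne (b : ι → ι → ℂ) (δ ρ A : ℝ) : Prop where
  entry : ∀ i j, ‖b i j - 1‖ ≤ δ
  row : ∀ i, ‖∑ j, (b i j - 1)‖ ≤ ρ
  col : ∀ j, ‖∑ i, (b i j - 1)‖ ≤ ρ
  absRow : ∀ i, ∑ j, ‖b i j - 1‖ ≤ A
  absCol : ∀ j, ∑ i, ‖b i j - 1‖ ≤ A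

lemma IsNearOne.swap {b : ι → ι → ℂ} {δ ρ A : ℝ} (h : IsNearOne b δ ρ A) :
    IsNearOne (fun j i => b i j) δ ρ A :=
  ⟨fun _ _ => h.entry _ _, h.col, h.row, h.absCol, h.absRow⟩

variable [DecidableEq ι]

/-- First round of `norm_subPerm_sub_le`, started from the crude ratio `8 δ`. -/
lemma IsNearOne.norm_subPerm_sub_le₁ {b : ι → ι → ℂ} {δ ρ A : ℝ} (h : IsNearOne b δ ρ A)
    (hδ : 0 ≤ δ) (hδ' : δ ≤ 1 / 20) {I J : Finset ι} (hJ : J.Nonempty)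
    (hcard : I.card = J.card + 1) {i i' : ι} (hi : i ∈ I) (hi' : i' ∈ I) (hne : i ≠ i') :
    ‖subPerm b (I.erase i') J - subPerm b (I.erase i) J‖ ≤
      (2 * ρ + 2 * (Jᶜ.card : ℝ) * δ + 2 * A * (8 * δ)) * (2 / J.card) *
        ‖subPerm b (I.erase i) J‖ := by
  refine norm_subPerm_sub_le hδ (by positivity) (by nlinarith) h.entry hi hi' hne hJ ?_
    (norm_sum_sub_le_of_card_compl J (h.entry i) (h.entry i') (h.row i) (h.row i') rfl)
    (sum_norm_sub_le_of_sum_norm_sub_one_le J (h.absRow i) (h.absRow i'))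
  intro l hl l' hl'
  have := norm_subPerm_erase_sub_le_of_card hδ hδ' (J.card - 1) (fun j i => b i j)
    (fun _ _ => h.entry _ _) J ((I.erase i).erase i')
    (by rw [Finset.card_erase_of_mem (Finset.mem_erase.2 ⟨hne.symm, hi'⟩),
      Finset.card_erase_of_mem hi]; omega)
    (by have := hJ.card_pos; omega) l' hl' l hl
  rwa [subPerm_swap b, subPerm_swap b] at this

/-- Second round, fed with the transpose of the first. For the matrix of transforms one round would
leave, after multiplication by the total size of the perturbation, an error of order `q √γ`, which
need not be small; the second round replaces it by `K⁴ γ² / n ≤ q²`. -/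
lemma IsNearOne.norm_subPerm_sub_le₂ {b : ι → ι → ℂ} {δ ρ A : ℝ} (h : IsNearOne b δ ρ A)
    (hδ : 0 ≤ δ) (hδ' : δ ≤ 1 / 100) (hρ : δ ≤ ρ) (hA : 0 ≤ A)
    {n : ℕ} (hn : Fintype.card ι = n) (hn4 : 4 ≤ n)
    (hAn : A ≤ n * δ) (hρn : ρ ≤ n * δ) (j i i' : ι) :
    ‖subPerm b (Finset.univ.erase i') (Finset.univ.erase j) -
      subPerm b (Finset.univ.erase i) (Finset.univ.erase j)‖ ≤
      (26 * ρ / n + 512 * (A / n) ^ 2 * δ) *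
        ‖subPerm b (Finset.univ.erase i) (Finset.univ.erase j)‖ := by
  have hn0 : (4 : ℝ) ≤ n := by exact_mod_cast hn4
  have hnpos : (0 : ℝ) < n := by linarith
  have hρ0 : 0 ≤ ρ := hδ.trans hρ
  rcases eq_or_ne i i' with rfl | hne
  · rw [sub_self, norm_zero]; positivity
  have hJ : (Finset.univ.erase j : Finset ι).card = n - 1 := by
    rw [Finset.card_erase_of_mem (Finset.mem_univ _), Finset.card_univ, hn]
  have hI2 : ((Finset.univ.erase i).erase i' : Finset ι).card = n - 2 := by
    rw [Finset.card_erase_of_mem (Finset.mem_erase.2 ⟨hne.symm, Finset.mem_univ _⟩),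
      Finset.card_erase_of_mem (Finset.mem_univ _), Finset.card_univ, hn]; omega
  have hJc : ((Finset.univ.erase j : Finset ι)ᶜ).card = 1 := by
    rw [Finset.card_compl, hJ, hn]; omega
  have hIc : (((Finset.univ.erase i).erase i' : Finset ι)ᶜ).card = 2 := by
    rw [Finset.card_compl, hI2, hn]; omega
  have hc1 : ((n - 1 : ℕ) : ℝ) = n - 1 := by rw [Nat.cast_sub (by omega)]; simp
  have hc2 : ((n - 2 : ℕ) : ℝ) = n - 2 := by rw [Nat.cast_sub (by omega)]; simp
  have hd1 : 2 / ((n : ℝ) - 1) ≤ 4 / n := by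
    rw [div_le_div_iff₀ (by linarith) hnpos]; linarith
  have hd2 : 2 / ((n : ℝ) - 2) ≤ 4 / n := by
    rw [div_le_div_iff₀ (by linarith) hnpos]; linarith
  have hd1' : 0 ≤ 2 / ((n : ℝ) - 1) := div_nonneg (by norm_num) (by linarith)
  have hd2' : 0 ≤ 2 / ((n : ℝ) - 2) := div_nonneg (by norm_num) (by linarith)
  set η : ℝ := (6 * ρ + 16 * A * δ) * (4 / n) with hη
  have hη0 : 0 ≤ η := by positivity
  set x : ℝ := A / n with hx
  set y : ℝ := ρ / n with hy
  have hxδ : x ≤ δ := by rw [hx, div_le_iff₀ hnpos]; linarith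
  have hyδ : y ≤ δ := by rw [hy, div_le_iff₀ hnpos]; linarith
  have hx0 : 0 ≤ x := by positivity
  have hy0 : 0 ≤ y := by positivity
  have hηxy : η = 24 * y + 64 * x * δ := by rw [hη, hx, hy]; field_simp; ring
  have hηδ : η ≤ 24 * δ + 64 * δ * δ := by rw [hηxy]; gcongr
  have hmul : ∀ s t : ℝ, 0 ≤ s → s ≤ 1 / 100 → 0 ≤ t → s * t ≤ t / 100 := by
    intro s t _ h1 h2; nlinarith
  have key := norm_subPerm_sub_le (b := b) (I := Finset.univ) (J := Finset.univ.erase j) (δ := δ)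
    (η := η) (r := 2 * ρ + 2 * (1 : ℕ) * δ) (α := 2 * A) hδ hη0
    (by linarith [hmul δ δ hδ hδ' hδ, hmul δ η hδ hδ' hη0])
    h.entry (Finset.mem_univ i) (Finset.mem_univ i') hne
    (Finset.card_pos.1 (by rw [hJ]; omega)) ?_
    (norm_sum_sub_le_of_card_compl _ (h.entry i) (h.entry i') (h.row i) (h.row i') hJc)
    (sum_norm_sub_le_of_sum_norm_sub_one_le _ (h.absRow i) (h.absRow i'))
  · refine key.trans (mul_le_mul_of_nonneg_right ?_ (norm_nonneg _))
    rw [hJ, hc1]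
    calc (2 * ρ + 2 * (1 : ℕ) * δ + 2 * A * η) * (2 / ((n : ℝ) - 1))
        ≤ (4 * ρ + 2 * A * η) * (4 / n) := by
          gcongr
          push_cast
          linarith
      _ = 16 * y + 8 * x * (24 * y + 64 * x * δ) := by rw [← hηxy, hx, hy]; field_simp; ring
      _ ≤ 26 * y + 512 * x ^ 2 * δ := by nlinarith [hmul x y hx0 (hxδ.trans hδ') hy0]
      _ = 26 * ρ / n + 512 * x ^ 2 * δ := by rw [hy]; ring
  · intro l hl l' hl'
    rcases eq_or_ne l' l with rfl | hll
    · rw [sub_self, norm_zero]; positivity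
    have h1 := h.swap.norm_subPerm_sub_le₁ hδ (hδ'.trans (by norm_num))
      (I := Finset.univ.erase j)
      (J := (Finset.univ.erase i).erase i') (Finset.card_pos.1 (by rw [hI2]; omega))
      (by rw [hI2, hJ]; omega) hl' hl hll
    rw [subPerm_swap b, subPerm_swap b] at h1
    refine h1.trans (mul_le_mul_of_nonneg_right ?_ (norm_nonneg _))
    rw [hI2, hIc, hc2, hη]
    refine mul_le_mul ?_ hd2 hd2' (by positivity)
    push_cast
    linarith

/-- Expand the full permanent along column `j`: all `n` minors nearly equal `p`, and the
coefficients sum to `n` up to `ρ`. -/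
lemma IsNearOne.norm_subPerm_univ_sub_le {b : ι → ι → ℂ} {δ ρ A : ℝ} (h : IsNearOne b δ ρ A)
    (hδ : 0 ≤ δ) (hδ' : δ ≤ 1 / 100) (hρ : δ ≤ ρ) (hA : 0 ≤ A)
    {n : ℕ} (hn : Fintype.card ι = n) (hn4 : 4 ≤ n)
    (hAn : A ≤ n * δ) (hρn : ρ ≤ n * δ) (i j : ι) :
    ‖n * subPerm b (Finset.univ.erase i) (Finset.univ.erase j) -
      subPerm b Finset.univ Finset.univ‖ ≤
      (106 * ρ / n + 2048 * (A / n) ^ 2 * δ) * ‖subPerm b Finset.univ Finset.univ‖ := by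
  have hn0 : (4 : ℝ) ≤ n := by exact_mod_cast hn4
  have hnpos : (0 : ℝ) < n := by linarith
  have hρ0 : 0 ≤ ρ := hδ.trans hρ
  set η : ℝ := 26 * ρ / n + 512 * (A / n) ^ 2 * δ with hη
  have hη0 : 0 ≤ η := by positivity
  set P := subPerm b Finset.univ Finset.univ
  set p := subPerm b (Finset.univ.erase i) (Finset.univ.erase j) with hp
  have hrat : ∀ k, ‖subPerm b (Finset.univ.erase k) (Finset.univ.erase j) - p‖ ≤ η * ‖p‖ :=
    fun k => h.norm_subPerm_sub_le₂ hδ hδ' hρ hA hn hn4 hAn hρn j i k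
  have hxδ : A / n ≤ δ := by rw [div_le_iff₀ hnpos]; linarith
  have hyδ : ρ / n ≤ δ := by rw [div_le_iff₀ hnpos]; linarith
  have hηδ : η ≤ 27 * δ := by
    rw [hη, mul_div_assoc]
    have h1 : (A / n) ^ 2 ≤ δ ^ 2 := by gcongr
    have h2 : (A / n) ^ 2 * δ ≤ δ ^ 2 * δ := by gcongr
    have h3 : δ ^ 2 ≤ 1 / 100 ^ 2 := by
      calc δ ^ 2 ≤ (1 / 100) ^ 2 := by gcongr
        _ = _ := by norm_num
    have h4 : δ ^ 2 * δ ≤ 1 / 100 ^ 2 * δ := by gcongr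
    linarith
  have hsmall : δ + η + δ * η ≤ 1 / 2 := by nlinarith
  have hlow : (n : ℝ) / 2 * ‖p‖ ≤ ‖P‖ := by
    have := norm_subPerm_ge (b := fun j i => b i j) (I := Finset.univ) (J := Finset.univ)
      (δ := δ) (η := η) (i := j) (l₀ := i) hδ hsmall (fun _ _ => h.entry _ _) (Finset.mem_univ _)
      (fun l _ => by rw [subPerm_swap b, subPerm_swap b]; exact hrat l)
    rwa [subPerm_swap b, subPerm_swap b, Finset.card_univ, hn] at this
  have hd : ‖n * p - P‖ ≤ (ρ + 2 * n * η) * ‖p‖ := by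
    have e : n * p - P = -((∑ k, (b k j - 1)) * p +
        ∑ k, b k j * (subPerm b (Finset.univ.erase k) (Finset.univ.erase j) - p)) := by
      have : P = ∑ k, b k j * subPerm b (Finset.univ.erase k) (Finset.univ.erase j) :=
        subPerm_col b _ (Finset.mem_univ j)
      rw [this]
      simp only [mul_sub, Finset.sum_sub_distrib, ← Finset.sum_mul, Finset.sum_const,
        Finset.card_univ, hn, nsmul_eq_mul]
      ring
    rw [e, norm_neg, add_mul]
    refine (norm_add_le _ _).trans (add_le_add ?_ ?_)
    · rw [norm_mul]; gcongr; exact h.col j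
    · have hb2 : ∀ k, ‖b k j‖ ≤ 2 := fun k => by
        have := norm_le_norm_sub_add (b k j) 1
        rw [norm_one] at this
        linarith [h.entry k j]
      calc _ ≤ ∑ _k : ι, 2 * (η * ‖p‖) := by
            refine norm_sum_le_of_le _ fun k _ => ?_
            rw [norm_mul]; gcongr
            · exact hb2 k
            · exact hrat k
        _ = _ := by
            rw [Finset.sum_const, Finset.card_univ, hn, nsmul_eq_mul]; ring
  -- The constants are `106 = 2 + 4 * 26` and `2048 = 4 * 512`.
  calc ‖n * p - P‖ ≤ (ρ + 2 * n * η) * ‖p‖ := hd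
    _ = (ρ + 2 * n * η) * (2 / n) * (n / 2 * ‖p‖) := by field_simp
    _ ≤ (ρ + 2 * n * η) * (2 / n) * ‖P‖ := by gcongr
    _ = _ := by rw [hη]; field_simp; ring

lemma hasDerivAt_subPerm (a : ι → ι → ℂ) (w : ℝ) :
    HasDerivAt (fun w : ℝ => subPerm (fun i j => 1 + w * a i j) Finset.univ Finset.univ)
      (∑ i, ∑ j, a i j * subPerm (fun i j => 1 + w * a i j) (Finset.univ.erase i)
        (Finset.univ.erase j)) w := by
  have h1 : ∀ e : ((Finset.univ : Finset ι) ≃ (Finset.univ : Finset ι)),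
      HasDerivAt (fun w : ℝ => ∏ i : (Finset.univ : Finset ι), (1 + (w : ℂ) * a i (e i)))
        (∑ i : (Finset.univ : Finset ι),
          (∏ k ∈ Finset.univ.erase i, (1 + (w : ℂ) * a k (e k))) • a i (e i)) w := by
    intro e
    refine HasDerivAt.fun_finsetProd (fun i _ => ?_)
    have := ((Complex.ofRealCLM.hasDerivAt (x := w)).mul_const (a i (e i))).const_add 1
    simpa using this
  have h2 := HasDerivAt.fun_sum (u := Finset.univ) (fun e _ => h1 e)
  refine h2.congr_deriv ?_
  rw [Finset.sum_comm, ← Finset.sum_coe_sort (Finset.univ : Finset ι)]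
  refine Finset.sum_congr rfl fun i _ => ?_
  rw [← sum_mul_prod_erase_eq (fun i j => 1 + w * a i j) (a i) Finset.univ i]
  simp only [smul_eq_mul, mul_comm]

lemma subPerm_univ (b : ι → ι → ℂ) :
    subPerm b Finset.univ Finset.univ = ∑ σ : Equiv.Perm ι, ∏ i, b i (σ i) := by
  refine Fintype.sum_equiv (Equiv.equivCongr (Equiv.subtypeUnivEquiv Finset.mem_univ)
    (Equiv.subtypeUnivEquiv Finset.mem_univ)) _ _ fun e => ?_
  refine Fintype.prod_equiv (Equiv.subtypeUnivEquiv Finset.mem_univ) _ _ fun i => ?_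
  simp [Equiv.subtypeUnivEquiv]

/-- The permanent of a matrix close to the all-ones matrix is `n! * exp (T / n)` up to a small
relative error, where `T` is the sum of the deviations. -/
theorem norm_sum_perm_prod_sub_le {a : ι → ι → ℂ} {δ ρ A L : ℝ}
    (h : IsNearOne (fun i j => 1 + a i j) δ ρ A)
    (hδ : 0 ≤ δ) (hδ' : δ ≤ 1 / 100) (hρ : δ ≤ ρ) (hA : 0 ≤ A)
    {n : ℕ} (hn : Fintype.card ι = n) (hn4 : 4 ≤ n)
    (hAn : A ≤ n * δ) (hρn : ρ ≤ n * δ) (hL : ∑ i, ∑ j, ‖a i j‖ ≤ n * L) {ε : ℝ}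
    (hε : L * (106 * ρ / n + 2048 * (A / n) ^ 2 * δ) ≤ ε) :
    ‖(∑ σ : Equiv.Perm ι, ∏ i, (1 + a i (σ i))) * Complex.exp (-(∑ i, ∑ j, a i j) / n) - (n ! : ℂ)‖ ≤
      (n ! : ℝ) * (ε * Real.exp ε) := by
  have hn0 : (4 : ℝ) ≤ n := by exact_mod_cast hn4
  have hnpos : (0 : ℝ) < n := by linarith
  have hnC : (n : ℂ) ≠ 0 := by exact_mod_cast hnpos.ne'
  have hρ0 : 0 ≤ ρ := hδ.trans hρ
  set T : ℂ := ∑ i, ∑ j, a i j with hT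
  set P : ℝ → ℂ := fun w => subPerm (fun i j => 1 + w * a i j) Finset.univ Finset.univ with hP
  -- Multiplying by `exp (-w T / n)` instead of taking a logarithm avoids any need to know that the
  -- permanent does not vanish along the path.
  set F : ℝ → ℂ := fun w => P w * Complex.exp (-(w * T / n)) with hF
  set F' : ℝ → ℂ := fun w => (∑ i, ∑ j, a i j * subPerm (fun i j => 1 + w * a i j)
    (Finset.univ.erase i) (Finset.univ.erase j) - T / n * P w) * Complex.exp (-(w * T / n)) with hF'
  have hder : ∀ w, HasDerivAt F (F' w) w := by
    intro w
    have h1 := hasDerivAt_subPerm a w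
    have h2 : HasDerivAt (fun w : ℝ => Complex.exp (-(w * T / n)))
        (Complex.exp (-(w * T / n)) * (-(T / n))) w := by
      have := (((Complex.ofRealCLM.hasDerivAt (x := w)).mul_const T).div_const (n : ℂ)).neg.cexp
      simpa using this
    refine (h1.mul h2).congr_deriv ?_
    simp only [hF', hP]; ring
  have hε0 : 0 ≤ ε := by
    have : 0 ≤ n * L := (Finset.sum_nonneg fun _ _ => Finset.sum_nonneg fun _ _ =>
      norm_nonneg _).trans hL
    have : 0 ≤ L := nonneg_of_mul_nonneg_right this hnpos
    exact le_trans (by positivity) hε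
  have hbound : ∀ w ∈ Set.Icc (0 : ℝ) 1, ‖F' w‖ ≤ ε * ‖F w‖ := by
    intro w hw
    have hnw : ‖(w : ℂ)‖ ≤ 1 := by simp [abs_of_nonneg hw.1, hw.2]
    have hsc : ∀ (z : ℂ), ‖(w : ℂ) * z‖ ≤ ‖z‖ := fun z => by
      rw [norm_mul]; exact mul_le_of_le_one_left (norm_nonneg _) hnw
    have hb : IsNearOne (fun i j => 1 + w * a i j) δ ρ A := by
      constructor
      · intro i j
        have := h.entry i j
        rw [add_sub_cancel_left] at this ⊢
        exact (hsc _).trans this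
      · intro i
        have := h.row i
        simp only [add_sub_cancel_left, ← Finset.mul_sum] at this ⊢
        exact (hsc _).trans this
      · intro i
        have := h.col i
        simp only [add_sub_cancel_left, ← Finset.mul_sum] at this ⊢
        exact (hsc _).trans this
      · intro i
        have := h.absRow i
        simp only [add_sub_cancel_left] at this ⊢
        exact (Finset.sum_le_sum fun _ _ => hsc _).trans this
      · intro i
        have := h.absCol i
        simp only [add_sub_cancel_left] at this ⊢
        exact (Finset.sum_le_sum fun _ _ => hsc _).trans this
    have e : ∑ i, ∑ j, a i j * subPerm (fun i j => 1 + w * a i j)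
        (Finset.univ.erase i) (Finset.univ.erase j) - T / n * P w =
        (∑ i, ∑ j, a i j * (n * subPerm (fun i j => 1 + w * a i j)
        (Finset.univ.erase i) (Finset.univ.erase j) - P w)) / n := by
      rw [eq_div_iff hnC]
      simp only [mul_sub, Finset.sum_sub_distrib, ← Finset.sum_mul, sub_mul, ← hT]
      congr 1
      · rw [Finset.sum_mul]
        refine Finset.sum_congr rfl fun i _ => ?_
        rw [Finset.sum_mul]
        refine Finset.sum_congr rfl fun j _ => ?_
        ring
      · field_simp
    have h3 : ‖(∑ i, ∑ j, a i j * (n * subPerm (fun i j => 1 + w * a i j)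
        (Finset.univ.erase i) (Finset.univ.erase j) - P w)) / n‖ ≤ ε * ‖P w‖ := by
      rw [norm_div, Complex.norm_natCast, div_le_iff₀ hnpos]
      set κ := 106 * ρ / n + 2048 * (A / n) ^ 2 * δ with hκ
      have hκ0 : 0 ≤ κ := by positivity
      calc _ ≤ ∑ i, ∑ j, ‖a i j‖ * (κ * ‖P w‖) := by
            refine norm_sum_le_of_le _ fun i _ => norm_sum_le_of_le _ fun j _ => ?_
            rw [norm_mul]
            gcongr
            exact hb.norm_subPerm_univ_sub_le hδ hδ' hρ hA hn hn4 hAn hρn i j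
        _ = (∑ i, ∑ j, ‖a i j‖) * (κ * ‖P w‖) := by simp only [Finset.sum_mul]
        _ ≤ (n * L) * (κ * ‖P w‖) := by gcongr
        _ = (L * κ) * ‖P w‖ * n := by ring
        _ ≤ _ := by gcongr
    simp only [hF', hF]
    rw [e, norm_mul, norm_mul, ← mul_assoc]
    gcongr
  have hP0 : F 0 = (n ! : ℂ) := by
    simp only [hF, hP, subPerm_univ]
    simp [Finset.card_univ, Fintype.card_perm, hn]
  -- Grönwall first bounds `F` itself; the bound `‖F'‖ ≤ ε ‖F‖` then becomes absolute, and the mean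
  -- value inequality controls `F 1 - F 0`.
  have hgron : ∀ w ∈ Set.Icc (0 : ℝ) 1, ‖F w‖ ≤ (n ! : ℝ) * Real.exp (ε * w) := by
    intro w hw
    have := norm_le_gronwallBound_of_norm_deriv_right_le (f := F) (f' := F') (δ := (n ! : ℝ)) (K := ε)
      (ε := 0) (a := 0) (b := 1)
      (fun x _ => (hder x).continuousAt.continuousWithinAt)
      (fun x _ => (hder x).hasDerivWithinAt) (by rw [hP0]; simp)
      (fun x hx => by rw [add_zero]; exact hbound x ⟨hx.1, hx.2.le⟩) w hw
    simpa [gronwallBound_ε0] using this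
  have hmv := Convex.norm_image_sub_le_of_norm_hasDerivWithin_le (f := F) (f' := F')
    (C := (n ! : ℝ) * (ε * Real.exp ε)) (s := Set.Icc (0 : ℝ) 1) (x := 0) (y := 1)
    (fun x _ => (hder x).hasDerivWithinAt) (fun x hx => by
      refine (hbound x hx).trans ?_
      calc ε * ‖F x‖ ≤ ε * ((n ! : ℝ) * Real.exp (ε * x)) := by gcongr; exact hgron x hx
        _ ≤ ε * ((n ! : ℝ) * Real.exp (ε * 1)) := by gcongr; exact hx.2
        _ = _ := by rw [mul_one]; ring) (convex_Icc _ _) (by simp) (by simp)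
  rw [hP0] at hmv
  simp only [hF, hP, subPerm_univ] at hmv
  simpa [neg_div] using hmv

end RefinedRatio

/-! ### Exponential moments and Taylor remainders under Bernstein-type moment conditions. -/

section MomentGenerating

variable {Ω : Type*} [MeasurableSpace Ω] {μ : Measure Ω}

lemma integrable_of_hasSum_of_summable_integral {F : ℕ → Ω → ℝ} {f : Ω → ℝ}
    (hF : ∀ k, Integrable (F k) μ) (hF0 : ∀ k ω, 0 ≤ F k ω)
    (hsum : Summable fun k => ∫ ω, F k ω ∂μ) (hf : ∀ ω, HasSum (F · ω) (f ω)) :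
    Integrable f μ := by
  have hfm : AEMeasurable f μ := by
    have h1 : f = fun ω => ∑' k, F k ω := funext fun ω => (hf ω).tsum_eq.symm
    have h2 : f = fun ω => (∑' k, ENNReal.ofReal (F k ω)).toReal := by
      rw [h1]; funext ω
      rw [← ENNReal.ofReal_tsum_of_nonneg (fun k => hF0 k ω) (hf ω).summable,
        ENNReal.toReal_ofReal (tsum_nonneg fun k => hF0 k ω)]
    rw [h2]
    exact (AEMeasurable.tsum fun k => (hF k).aemeasurable.ennreal_ofReal).ennreal_toReal
  have hf0 : ∀ ω, 0 ≤ f ω := fun ω => (hf ω).nonneg (fun k => hF0 k ω)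
  refine ⟨hfm.aestronglyMeasurable, ?_⟩
  rw [hasFiniteIntegral_iff_ofReal (Eventually.of_forall hf0)]
  have h3 : ∀ ω, ENNReal.ofReal (f ω) = ∑' k, ENNReal.ofReal (F k ω) := fun ω => by
    rw [← ENNReal.ofReal_tsum_of_nonneg (fun k => hF0 k ω) (hf ω).summable, (hf ω).tsum_eq]
  simp_rw [h3]
  rw [lintegral_tsum fun k => (hF k).aemeasurable.ennreal_ofReal]
  simp_rw [← fun k => ofReal_integral_eq_lintegral_ofReal (hF k) (Eventually.of_forall (hF0 k))]
  exact hsum.tsum_ofReal_lt_top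

variable {X : Ω → ℝ} {D M : ℝ}

/-- The hypothesis controls signed moments, hence absolute ones only for even exponents. The series
of `cosh` uses just these, and `exp (h |X|) ≤ 2 cosh (h X)`. -/
lemma integrable_exp_mul_abs (hX : Measurable X)
    (hmom : ∀ k : ℕ, Integrable (fun ω => X ω ^ k) μ) (hM : 0 < M)
    (hbern : ∀ k : ℕ, 1 ≤ k →
      |∫ ω, X ω ^ k ∂μ| ≤ D * (k ! : ℝ) * M ^ (k - 1) * ∫ ω, |X ω| ^ 1 ∂μ)
    {h : ℝ} (hh : 0 ≤ h) (hhM : h * M < 1) :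
    Integrable (fun ω => Real.exp (h * |X ω|)) μ := by
  have hcosh : Integrable (fun ω => Real.cosh (h * X ω)) μ := by
    refine integrable_of_hasSum_of_summable_integral
      (F := fun k ω => (h * X ω) ^ (2 * k) / ((2 * k)! : ℝ)) ?_ ?_ ?_
      fun ω => Real.hasSum_cosh (h * X ω)
    · intro k
      simp_rw [mul_pow, mul_div_right_comm]
      exact (hmom _).const_mul _
    · intro k ω
      rw [pow_mul]; positivity
    · have h0 : ∀ k, 0 ≤ ∫ ω, (h * X ω) ^ (2 * k) / ((2 * k)! : ℝ) ∂μ := fun k =>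
        integral_nonneg fun ω => by rw [Pi.zero_apply, pow_mul]; positivity
      -- The zeroth moment is set aside because the moment bound starts at exponent `1`.
      rw [← summable_nat_add_iff 1]
      refine Summable.of_nonneg_of_le (fun k => h0 _) (f := fun k : ℕ =>
        (D * h * ∫ ω, |X ω| ^ 1 ∂μ) * (h * M) * ((h * M) ^ 2) ^ k) ?_ ?_
      · intro k
        simp_rw [mul_pow, mul_div_right_comm]
        rw [integral_const_mul]
        have h1 := (le_abs_self _).trans (hbern (2 * (k + 1)) (by omega))
        calc h ^ (2 * (k + 1)) / ((2 * (k + 1))! : ℝ) * ∫ ω, X ω ^ (2 * (k + 1)) ∂μ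
            ≤ h ^ (2 * (k + 1)) / ((2 * (k + 1))! : ℝ) * (D * ((2 * (k + 1))! : ℝ) *
              M ^ (2 * (k + 1) - 1) * ∫ ω, |X ω| ^ 1 ∂μ) := by gcongr
          _ = _ := by
            have : ((2 * (k + 1))! : ℝ) ≠ 0 := by positivity
            rw [show 2 * (k + 1) - 1 = 2 * k + 1 by omega]
            field_simp
            ring
      · refine (summable_geometric_of_lt_one (by positivity) ?_).mul_left _
        have : 0 ≤ h * M := by positivity
        nlinarith
  refine (hcosh.const_mul 2).mono' (by fun_prop) (Eventually.of_forall fun ω => ?_)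
  rw [Real.norm_eq_abs, Real.abs_exp, Real.cosh_eq]
  rcases abs_cases (X ω) with ⟨h1, _⟩ | ⟨h1, _⟩ <;> rw [h1]
  · linarith [Real.exp_pos (-(h * X ω))]
  · rw [mul_neg]; linarith [Real.exp_pos (h * X ω)]

lemma norm_cexp_mul_ofReal_le (z : ℂ) (x : ℝ) : ‖Complex.exp (z * x)‖ ≤ Real.exp (‖z‖ * |x|) := by
  rw [Complex.norm_exp]
  gcongr
  refine (Complex.re_le_norm _).trans ?_
  rw [norm_mul, Complex.norm_real, Real.norm_eq_abs]

lemma hasSum_integral_cexp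
    (hmom : ∀ k : ℕ, Integrable (fun ω => X ω ^ k) μ) {z : ℂ}
    (hexp : Integrable (fun ω => Real.exp (‖z‖ * |X ω|)) μ) :
    HasSum (fun k : ℕ => z ^ k / (k ! : ℂ) * ((∫ ω, X ω ^ k ∂μ : ℝ) : ℂ))
      (∫ ω, Complex.exp (z * X ω) ∂μ) := by
  set F : ℕ → Ω → ℂ := fun k ω => z ^ k / (k ! : ℂ) * ((X ω ^ k : ℝ) : ℂ) with hF
  have hFint : ∀ k, Integrable (F k) μ := fun k => (hmom k).ofReal.const_mul _
  have hnorm : ∀ k ω, ‖F k ω‖ = (‖z‖ * |X ω|) ^ k / (k ! : ℝ) := fun k ω => by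
    simp only [hF, norm_mul, norm_div, norm_pow, Complex.norm_real, Real.norm_eq_abs,
      Complex.norm_natCast, mul_pow]
    ring
  have hexpsum : ∀ ω, HasSum (fun k => ‖F k ω‖) (Real.exp (‖z‖ * |X ω|)) := fun ω => by
    simp_rw [hnorm]
    rw [Real.exp_eq_exp_ℝ]
    exact NormedSpace.expSeries_div_hasSum_exp _
  have hsumm : Summable fun k => ∫ ω, ‖F k ω‖ ∂μ := by
    refine summable_of_sum_le (c := ∫ ω, Real.exp (‖z‖ * |X ω|) ∂μ)
      (fun k => integral_nonneg fun ω => norm_nonneg _) fun s => ?_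
    rw [← integral_finsetSum _ fun k _ => (hFint k).norm]
    exact integral_mono (integrable_finsetSum _ fun k _ => (hFint k).norm) hexp
      fun ω => sum_le_hasSum s (fun _ _ => norm_nonneg _) (hexpsum ω)
  have key := hasSum_integral_of_summable_integral_norm hFint hsumm
  have h1 : ∀ ω, ∑' k, F k ω = Complex.exp (z * X ω) := fun ω => by
    have : HasSum (F · ω) (Complex.exp (z * X ω)) := by
      rw [Complex.exp_eq_exp_ℂ]
      convert! NormedSpace.expSeries_div_hasSum_exp (𝔸 := ℂ) (z * X ω) using 2 with k
      simp only [hF]; push_cast; ring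
    exact this.tsum_eq
  simp_rw [h1] at key
  convert! key using 2 with k
  simp only [hF]
  rw [integral_const_mul, integral_complex_ofReal]

/-- The factorials in the moment bound cancel those of the exponential series, so the remainder is
dominated by a geometric series of ratio at most `1 / 2`. -/
lemma norm_integral_cexp_sub_sum_le
    (hmom : ∀ k : ℕ, Integrable (fun ω => X ω ^ k) μ) (hD : 0 < D) (hM : 0 < M) (s : ℕ)
    (hbern : ∀ k : ℕ, s ≤ k →
      |∫ ω, X ω ^ k ∂μ| ≤ D * (k ! : ℝ) * M ^ (k - s) * ∫ ω, |X ω| ^ s ∂μ) {z : ℂ}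
    (hexp : Integrable (fun ω => Real.exp (‖z‖ * |X ω|)) μ) (hz : ‖z‖ * M ≤ 1 / 2) :
    ‖∫ ω, Complex.exp (z * X ω) ∂μ -
      ∑ k ∈ Finset.range s, z ^ k / (k ! : ℂ) * ((∫ ω, X ω ^ k ∂μ : ℝ) : ℂ)‖ ≤
      2 * D * ‖z‖ ^ s * ∫ ω, |X ω| ^ s ∂μ := by
  have hS := hasSum_integral_cexp hmom hexp
  have htail := (hasSum_nat_add_iff' s).2 hS
  rw [← htail.tsum_eq]
  set c := ∫ ω, |X ω| ^ s ∂μ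
  have hc : 0 ≤ c := integral_nonneg fun ω => by positivity
  have hq : 0 ≤ ‖z‖ * M := by positivity
  have hg := (hasSum_geometric_of_lt_one hq (by linarith)).mul_left (D * ‖z‖ ^ s * c)
  refine (tsum_of_norm_bounded hg fun k => ?_).trans ?_
  · rw [norm_mul, norm_div, norm_pow, Complex.norm_natCast, Complex.norm_real, Real.norm_eq_abs]
    have hb := hbern (k + s) (by omega)
    rw [Nat.add_sub_cancel] at hb
    calc ‖z‖ ^ (k + s) / ((k + s)! : ℝ) * |∫ ω, X ω ^ (k + s) ∂μ|
        ≤ ‖z‖ ^ (k + s) / ((k + s)! : ℝ) * (D * ((k + s)! : ℝ) * M ^ k * c) := by gcongr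
      _ = _ := by
        have : ((k + s)! : ℝ) ≠ 0 := by positivity
        field_simp; ring
  · have : (1 - ‖z‖ * M)⁻¹ ≤ 2 := by
      rw [inv_le_comm₀ (by linarith) (by norm_num)]; linarith
    calc D * ‖z‖ ^ s * c * (1 - ‖z‖ * M)⁻¹ ≤ D * ‖z‖ ^ s * c * 2 := by gcongr
      _ = _ := by ring

end MomentGenerating

/-! ### The transform of the combinatorial sum as a permanent. -/

section CombSum

variable {Ω : Type*} [MeasurableSpace Ω] {μ : Measure Ω}

lemma iIndepFun.integrable_fun_prod_comp {ι : Type*} [Fintype ι] {X : ι → Ω → ℝ}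
    (hX : iIndepFun X μ) (mX : ∀ i, Measurable (X i)) {f : ℝ → ℂ} (hf : Measurable f)
    (hint : ∀ i, Integrable (fun ω => f (X i ω)) μ) :
    Integrable (fun ω => ∏ i, f (X i ω)) μ := by
  have := hX.isProbabilityMeasure
  have h1 : ∀ i, Integrable f (μ.map (X i)) := fun i =>
    (integrable_map_measure hf.aestronglyMeasurable (mX i).aemeasurable).2 (hint i)
  have : ∀ i, IsProbabilityMeasure (μ.map (X i)) := fun i =>
    Measure.isProbabilityMeasure_map (mX i).aemeasurable
  have h2 := Integrable.fintype_prod (f := fun _ : ι => f) (μ := fun i => μ.map (X i)) h1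
  rw [← hX.map_fun_eq_pi_map fun i => (mX i).aemeasurable] at h2
  exact h2.comp_measurable (measurable_pi_lambda _ mX)

variable {n : ℕ} {X : Fin n → Fin n → Ω → ℝ} {π : Ω → Equiv.Perm (Fin n)}

lemma measurable_combSum (hX : ∀ i j, Measurable (X i j)) (hπ : Measurable π) :
    Measurable (combSum X π) := by
  have h1 : combSum X π = fun ω => ∑ σ : Equiv.Perm (Fin n),
      Set.indicator (π ⁻¹' {σ}) (fun ω => ∑ i, X i (σ i) ω) ω := by
    funext ω
    rw [Finset.sum_eq_single (π ω)]
    · simp [combSum]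
    · intro σ _ hσ
      rw [Set.indicator_of_notMem]
      simpa using hσ.symm
    · simp
  rw [h1]
  refine Finset.measurable_fun_sum _ fun σ _ => Measurable.indicator ?_ (hπ trivial)
  exact Finset.measurable_fun_sum _ fun i _ => hX _ _

-- Splitting over the finitely many values of the permutation separates its randomness from that of
-- the matrix.
omit [MeasurableSpace Ω] in
lemma cexp_mul_combSum (z : ℂ) (ω : Ω) :
    Complex.exp (z * combSum X π ω) = ∑ σ : Equiv.Perm (Fin n),
      Set.indicator {σ} (fun _ => (1 : ℂ)) (π ω) * ∏ i, Complex.exp (z * X i (σ i) ω) := by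
  rw [Finset.sum_eq_single (π ω)]
  · simp [combSum, Finset.mul_sum, Complex.exp_sum]
  · intro σ _ hσ
    rw [Set.indicator_of_notMem (by simpa using hσ.symm), zero_mul]
  · simp

lemma integrable_prod_cexp (hX : ∀ i j, Measurable (X i j))
    (hind : iIndepFun (fun (p : Fin n × Fin n) => X p.1 p.2) μ) {z : ℂ}
    (hexp : ∀ i j, Integrable (fun ω => Real.exp (‖z‖ * |X i j ω|)) μ) (σ : Equiv.Perm (Fin n)) :
    Integrable (fun ω => ∏ i, Complex.exp (z * X i (σ i) ω)) μ := by
  have hinj : Function.Injective (fun i : Fin n => (i, σ i)) := fun a b h => (Prod.ext_iff.1 h).1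
  refine iIndepFun.integrable_fun_prod_comp (X := fun i => X i (σ i)) (hind.precomp hinj)
    (fun i => hX _ _) (f := fun x : ℝ => Complex.exp (z * x)) (by fun_prop) fun i => ?_
  exact (hexp i (σ i)).mono' (by have := hX i (σ i); fun_prop)
    (Eventually.of_forall fun ω => norm_cexp_mul_ofReal_le _ _)

lemma integral_prod_cexp (hX : ∀ i j, Measurable (X i j))
    (hind : iIndepFun (fun (p : Fin n × Fin n) => X p.1 p.2) μ) (z : ℂ)
    (σ : Equiv.Perm (Fin n)) :
    ∫ ω, ∏ i, Complex.exp (z * X i (σ i) ω) ∂μ =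
      ∏ i, ∫ ω, Complex.exp (z * X i (σ i) ω) ∂μ := by
  have hinj : Function.Injective (fun i : Fin n => (i, σ i)) := fun a b h => (Prod.ext_iff.1 h).1
  exact (hind.precomp hinj).integral_fun_prod_comp
    (f := fun (_ : Fin n) (x : ℝ) => Complex.exp (z * x))
    (fun i => (hX _ _).aemeasurable) (fun i => (by fun_prop : Measurable _).aestronglyMeasurable)

lemma integrable_cexp_combSum (hX : ∀ i j, Measurable (X i j))
    (hind : iIndepFun (fun (p : Fin n × Fin n) => X p.1 p.2) μ) (hπ : Measurable π) {z : ℂ}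
    (hexp : ∀ i j, Integrable (fun ω => Real.exp (‖z‖ * |X i j ω|)) μ) :
    Integrable (fun ω => Complex.exp (z * combSum X π ω)) μ := by
  simp_rw [cexp_mul_combSum]
  refine integrable_finsetSum _ fun σ _ => ?_
  refine (integrable_prod_cexp hX hind hexp σ).bdd_mul (c := 1) ?_
    (Eventually.of_forall fun ω => ?_)
  · have hm : Measurable (Set.indicator {σ} (fun _ : Equiv.Perm (Fin n) => (1 : ℂ))) :=
      measurable_from_top
    exact (hm.comp hπ).aestronglyMeasurable
  · by_cases h : π ω = σ <;> simp [Set.indicator, h]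

lemma integral_cexp_combSum (hX : ∀ i j, Measurable (X i j))
    (hind : iIndepFun (fun (p : Fin n × Fin n) => X p.1 p.2) μ) (hπ : IsUniformPerm π μ)
    (hπX : IndepFun π (fun ω i j => X i j ω) μ) {z : ℂ}
    (hexp : ∀ i j, Integrable (fun ω => Real.exp (‖z‖ * |X i j ω|)) μ) :
    ∫ ω, Complex.exp (z * combSum X π ω) ∂μ =
      (n ! : ℂ)⁻¹ * ∑ σ : Equiv.Perm (Fin n),
        ∏ i, ∫ ω, Complex.exp (z * X i (σ i) ω) ∂μ := by
  have hm : ∀ σ, Measurable (Set.indicator {σ} (fun _ : Equiv.Perm (Fin n) => (1 : ℂ))) :=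
    fun σ => measurable_from_top
  have hbd : ∀ σ : Equiv.Perm (Fin n), Integrable (fun ω =>
      Set.indicator {σ} (fun _ => (1 : ℂ)) (π ω) * ∏ i, Complex.exp (z * X i (σ i) ω)) μ := by
    intro σ
    refine (integrable_prod_cexp hX hind hexp σ).bdd_mul (c := 1)
      ((hm σ).comp hπ.1).aestronglyMeasurable (Eventually.of_forall fun ω => ?_)
    by_cases h : π ω = σ <;> simp [Set.indicator, h]
  simp_rw [cexp_mul_combSum]
  rw [integral_finsetSum _ fun σ _ => hbd σ, Finset.mul_sum]
  refine Finset.sum_congr rfl fun σ _ => ?_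
  have hXm : Measurable (fun ω i j => X i j ω) :=
    measurable_pi_lambda _ fun i => measurable_pi_lambda _ fun j => hX i j
  have hg : Measurable (fun x : Fin n → Fin n → ℝ => ∏ i, Complex.exp (z * x i (σ i))) := by
    fun_prop
  have h1 := hπX.integral_fun_comp_mul_comp (f := Set.indicator {σ} (fun _ => (1 : ℂ)))
    (g := fun x : Fin n → Fin n → ℝ => ∏ i, Complex.exp (z * x i (σ i)))
    hπ.1.aemeasurable hXm.aemeasurable (hm σ).aestronglyMeasurable hg.aestronglyMeasurable
  rw [h1, integral_prod_cexp hX hind]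
  congr 1
  have h2 : (fun ω => Set.indicator {σ} (fun _ => (1 : ℂ)) (π ω)) =
      Set.indicator (π ⁻¹' {σ}) (fun _ => (1 : ℂ)) := by
    funext ω; simp [Set.indicator]
  rw [h2, integral_indicator_const _ (hπ.1 trivial), measureReal_def, hπ.2 σ]
  simp

end CombSum

/-- The relative error of the Gaussian approximation of the moment generating function. -/
noncomputable def mgfError (D q : ℝ) : ℝ :=
  let ε := 424 * D ^ 2 * q + 32768 * D ^ 4 * q ^ 2
  ε * Real.exp ε * (1 + 4 * D * q) + 4 * D * q

lemma tendsto_mgfError (D : ℝ) : Tendsto (mgfError D) (nhds 0) (nhds 0) := by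
  have h : Continuous (mgfError D) := by unfold mgfError; fun_prop
  simpa [mgfError] using h.tendsto 0

/-! ### Estimates for the matrix of transforms and the Gaussian approximation. -/

section BernsteinArray

variable {Ω : Type*} [MeasurableSpace Ω]

/-- A doubly centred random matrix satisfying moment conditions of Bernstein type. -/
structure IsBernsteinArray {n : ℕ} (X : Fin n → Fin n → Ω → ℝ) (μ : Measure Ω) (D M : ℝ) :
    Prop where
  meas : ∀ i j, Measurable (X i j)
  mom : ∀ i j, ∀ k : ℕ, Integrable (fun ω => X i j ω ^ k) μ
  col : ∀ j, ∑ i, ∫ ω, X i j ω ∂μ = 0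
  row : ∀ i, ∑ j, ∫ ω, X i j ω ∂μ = 0
  D_pos : 0 < D
  M_pos : 0 < M
  bern : ∀ i j, ∀ s ∈ ({1, 2, 3} : Set ℕ), ∀ k : ℕ, s ≤ k →
    |∫ ω, X i j ω ^ k ∂μ| ≤ D * (k ! : ℝ) * M ^ (k - s) * ∫ ω, |X i j ω| ^ s ∂μ

variable {n : ℕ} {X : Fin n → Fin n → Ω → ℝ} {μ : Measure Ω} {D M : ℝ}

lemma normB_nonneg : 0 ≤ normB X μ :=
  mul_nonneg (by positivity) (Finset.sum_nonneg fun _ _ => Finset.sum_nonneg fun _ _ =>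
    integral_nonneg fun _ => by positivity)

lemma sum_sq_div_normB (hn : n ≠ 0) (hB : 0 < normB X μ) :
    ∑ i, ∑ j, (∫ ω, X i j ω ^ 2 ∂μ) / normB X μ = n := by
  have h : n * normB X μ = ∑ i, ∑ j, ∫ ω, X i j ω ^ 2 ∂μ := by
    rw [normB, ← mul_assoc, mul_one_div_cancel (by exact_mod_cast hn), one_mul]
  simp_rw [← Finset.sum_div]
  rw [← h, mul_div_cancel_right₀ _ hB.ne']

lemma sqrt_div_mul_le_lyapGamma (i j : Fin n) :
    √(n : ℝ) / √(normB X μ) * ∫ ω, |X i j ω| ∂μ ≤ lyapGamma X μ :=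
  (le_ciSup (f := fun p : Fin n × Fin n => √(n : ℝ) / √(normB X μ) * ∫ ω, |X p.1 p.2 ω| ∂μ)
    (Set.finite_range _).bddAbove (i, j)).trans (le_max_left _ _)

lemma row_sum_sq_le_lyapGamma (i : Fin n) :
    ∑ j, (∫ ω, X i j ω ^ 2 ∂μ) / normB X μ ≤ lyapGamma X μ :=
  (le_ciSup (f := fun i : Fin n => ∑ j, (∫ ω, X i j ω ^ 2 ∂μ) / normB X μ)
    (Set.finite_range _).bddAbove i).trans ((le_max_left _ _).trans (le_max_right _ _))

lemma col_sum_sq_le_lyapGamma (j : Fin n) :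
    ∑ i, (∫ ω, X i j ω ^ 2 ∂μ) / normB X μ ≤ lyapGamma X μ :=
  (le_ciSup (f := fun j : Fin n => ∑ i, (∫ ω, X i j ω ^ 2 ∂μ) / normB X μ)
    (Set.finite_range _).bddAbove j).trans
    ((le_max_left _ _).trans ((le_max_right _ _).trans (le_max_right _ _)))

lemma sum_cube_le_lyapGamma :
    ∑ i, ∑ j, (∫ ω, |X i j ω| ^ 3 ∂μ) / (√(n : ℝ) * normB X μ ^ (3 / 2 : ℝ)) ≤ lyapGamma X μ :=
  (le_max_right _ _).trans ((le_max_right _ _).trans (le_max_right _ _))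

/-- The normalised row sums of second moments average to `1`, so the largest is at least `1`. -/
lemma one_le_lyapGamma (hn : n ≠ 0) (hB : 0 < normB X μ) : 1 ≤ lyapGamma X μ := by
  have h1 : (n : ℝ) ≤ n * lyapGamma X μ := by
    calc (n : ℝ) = ∑ i, ∑ j, (∫ ω, X i j ω ^ 2 ∂μ) / normB X μ := (sum_sq_div_normB hn hB).symm
      _ ≤ ∑ _i : Fin n, lyapGamma X μ :=
        Finset.sum_le_sum fun i _ => row_sum_sq_le_lyapGamma i
      _ = _ := by simp
  have : (0 : ℝ) < n := by exact_mod_cast Nat.pos_of_ne_zero hn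
  nlinarith

lemma IsBernsteinArray.integrable_abs_pow (h : IsBernsteinArray X μ D M) (i j : Fin n) (k : ℕ) :
    Integrable (fun ω => |X i j ω| ^ k) μ := by
  simpa [abs_pow] using (h.mom i j k).abs

lemma IsBernsteinArray.integrable_exp (h : IsBernsteinArray X μ D M) (i j : Fin n) {r : ℝ}
    (hr : 0 ≤ r) (hrM : r * M < 1) : Integrable (fun ω => Real.exp (r * |X i j ω|)) μ :=
  integrable_exp_mul_abs (h.meas i j) (h.mom i j) h.M_pos
    (fun k hk => h.bern i j 1 (by simp) k hk) hr hrM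

lemma IsBernsteinArray.sq_integral_abs_le [IsProbabilityMeasure μ] (h : IsBernsteinArray X μ D M)
    (i j : Fin n) : (∫ ω, |X i j ω| ∂μ) ^ 2 ≤ ∫ ω, X i j ω ^ 2 ∂μ := by
  set c := ∫ ω, |X i j ω| ∂μ with hc
  have h1 : Integrable (fun ω => |X i j ω|) μ := by simpa using h.integrable_abs_pow i j 1
  have h2 : 0 ≤ ∫ ω, (X i j ω ^ 2 - 2 * c * |X i j ω| + c ^ 2) ∂μ :=
    integral_nonneg fun ω => by
      have : X i j ω ^ 2 - 2 * c * |X i j ω| + c ^ 2 = (|X i j ω| - c) ^ 2 := by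
        rw [← sq_abs (X i j ω)]; ring
      rw [Pi.zero_apply, this]; positivity
  have h3 : Integrable (fun ω => X i j ω ^ 2 - 2 * c * |X i j ω|) μ :=
    (h.mom i j 2).sub (h1.const_mul _)
  rw [integral_add h3 (integrable_const _), integral_sub (h.mom i j 2) (h1.const_mul _), integral_const_mul, ← hc] at h2
  simp only [integral_const, probReal_univ, one_smul] at h2
  nlinarith

/-- The deviation from `1` of the moment generating function of a normalised entry. -/
noncomputable def mgfDev (X : Fin n → Fin n → Ω → ℝ) (μ : Measure Ω) (z : ℂ) (i j : Fin n) : ℂ :=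
  ∫ ω, Complex.exp (z / √(normB X μ) * X i j ω) ∂μ - 1

section Estimates

variable (h : IsBernsteinArray X μ D M) (hB : 0 < normB X μ) {K : ℝ}
  (hKM : K * M ≤ √(normB X μ) / 2) {z : ℂ} (hz : ‖z‖ ≤ K)

include h hB hKM hz

lemma IsBernsteinArray.norm_div_mul_le : ‖z / √(normB X μ)‖ * M ≤ 1 / 2 := by
  have hb : 0 < √(normB X μ) := Real.sqrt_pos.2 hB
  rw [norm_div, Complex.norm_real, Real.norm_of_nonneg hb.le, div_mul_eq_mul_div,
    div_le_iff₀ hb]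
  have := mul_le_mul_of_nonneg_right hz h.M_pos.le
  linarith

lemma IsBernsteinArray.integrable_exp_div (i j : Fin n) :
    Integrable (fun ω => Real.exp (‖z / √(normB X μ)‖ * |X i j ω|)) μ :=
  h.integrable_exp i j (norm_nonneg _) ((h.norm_div_mul_le hB hKM hz).trans_lt (by norm_num))

lemma IsBernsteinArray.norm_integral_cexp_div_sub_le (i j : Fin n) {s : ℕ}
    (hs : s ∈ ({1, 2, 3} : Set ℕ)) :
    ‖∫ ω, Complex.exp (z / √(normB X μ) * X i j ω) ∂μ - ∑ k ∈ Finset.range s,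
      (z / √(normB X μ)) ^ k / (k ! : ℂ) * ((∫ ω, X i j ω ^ k ∂μ : ℝ) : ℂ)‖ ≤
      2 * D * K ^ s * ((∫ ω, |X i j ω| ^ s ∂μ) / √(normB X μ) ^ s) := by
  have hb : 0 < √(normB X μ) := Real.sqrt_pos.2 hB
  have hD := h.D_pos
  refine (norm_integral_cexp_sub_sum_le (h.mom i j) h.D_pos h.M_pos s
    (fun k hk => h.bern i j s hs k hk) (h.integrable_exp_div hB hKM hz i j)
    (h.norm_div_mul_le hB hKM hz)).trans ?_
  have hc : 0 ≤ ∫ ω, |X i j ω| ^ s ∂μ := integral_nonneg fun ω => by positivity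
  rw [norm_div, Complex.norm_real, Real.norm_of_nonneg hb.le, div_pow]
  calc 2 * D * (‖z‖ ^ s / √(normB X μ) ^ s) * ∫ ω, |X i j ω| ^ s ∂μ
      ≤ 2 * D * (K ^ s / √(normB X μ) ^ s) * ∫ ω, |X i j ω| ^ s ∂μ := by gcongr
    _ = _ := by ring

variable [IsProbabilityMeasure μ]

lemma IsBernsteinArray.norm_mgfDev_le_abs (i j : Fin n) :
    ‖mgfDev X μ z i j‖ ≤ 2 * D * K * ((∫ ω, |X i j ω| ∂μ) / √(normB X μ)) := by
  simpa [mgfDev] using h.norm_integral_cexp_div_sub_le hB hKM hz i j (s := 1) (by simp)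

lemma IsBernsteinArray.norm_mgfDev_sub_le_sq (i j : Fin n) :
    ‖mgfDev X μ z i j - z / √(normB X μ) * ((∫ ω, X i j ω ∂μ : ℝ) : ℂ)‖ ≤
      2 * D * K ^ 2 * ((∫ ω, X i j ω ^ 2 ∂μ) / normB X μ) := by
  have := h.norm_integral_cexp_div_sub_le hB hKM hz i j (s := 2) (by simp)
  simpa [mgfDev, Finset.sum_range_succ, sub_sub, Real.sq_sqrt hB.le] using this

lemma IsBernsteinArray.norm_mgfDev_sub_le_cube (i j : Fin n) :
    ‖mgfDev X μ z i j - z / √(normB X μ) * ((∫ ω, X i j ω ∂μ : ℝ) : ℂ) -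
      z ^ 2 / 2 * (((∫ ω, X i j ω ^ 2 ∂μ) / normB X μ : ℝ) : ℂ)‖ ≤
      2 * D * K ^ 3 * ((∫ ω, |X i j ω| ^ 3 ∂μ) / normB X μ ^ (3 / 2 : ℝ)) := by
  have h1 := h.norm_integral_cexp_div_sub_le hB hKM hz i j (s := 3) (by simp)
  have h2 : √(normB X μ) ^ 3 = normB X μ ^ (3 / 2 : ℝ) := by
    rw [Real.sqrt_eq_rpow, ← Real.rpow_natCast, ← Real.rpow_mul hB.le]; norm_num
  have h3 : (√(normB X μ) : ℂ) ^ 2 = normB X μ := by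
    rw [← Complex.ofReal_pow, Real.sq_sqrt hB.le]
  rw [h2] at h1
  refine le_of_eq_of_le ?_ h1
  congr 1
  simp only [mgfDev, Finset.sum_range_succ, Finset.sum_range_zero, div_pow, h3]
  simp
  ring

/-- Entries use the first-order bound `s = 1`. In signed row and column sums the linear terms cancel
by centring, leaving the bound `s = 2`. Absolute sums come from `s = 1` and Cauchy–Schwarz. -/
lemma IsBernsteinArray.isNearOne (hn : 4 ≤ n) (hK : 1 ≤ K) :
    IsNearOne (fun i j => 1 + mgfDev X μ z i j) (2 * D * K * (lyapGamma X μ / √n))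
      (2 * D * K ^ 2 * lyapGamma X μ) (2 * D * K * (√n * √(lyapGamma X μ))) := by
  have hD := h.D_pos
  have hb : 0 < √(normB X μ) := Real.sqrt_pos.2 hB
  have hn0 : 0 < √(n : ℝ) := Real.sqrt_pos.2 (by exact_mod_cast (by omega : 0 < n))
  have hsq : ∀ i j, ((∫ ω, |X i j ω| ∂μ) / √(normB X μ)) ^ 2 ≤
      (∫ ω, X i j ω ^ 2 ∂μ) / normB X μ := fun i j => by
    rw [div_pow, Real.sq_sqrt hB.le]
    gcongr
    exact h.sq_integral_abs_le i j
  have hcs : ∀ f : Fin n → ℝ, ∑ j, f j ^ 2 ≤ lyapGamma X μ →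
      ∑ j, f j ≤ √n * √(lyapGamma X μ) := fun f hf => by
    rw [← Real.sqrt_mul (by positivity)]
    refine Real.le_sqrt_of_sq_le ?_
    refine (sq_sum_le_card_mul_sum_sq).trans ?_
    rw [Finset.card_univ, Fintype.card_fin]
    gcongr
  constructor
  · intro i j
    rw [add_sub_cancel_left]
    refine (h.norm_mgfDev_le_abs hB hKM hz i j).trans ?_
    gcongr 2 * D * K * ?_
    have := sqrt_div_mul_le_lyapGamma (X := X) (μ := μ) i j
    rw [le_div_iff₀ hn0]
    calc _ = _ := by ring
      _ ≤ _ := this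
  · intro i
    simp only [add_sub_cancel_left]
    have e : ∑ j, mgfDev X μ z i j = ∑ j, (mgfDev X μ z i j -
        z / √(normB X μ) * ((∫ ω, X i j ω ∂μ : ℝ) : ℂ)) := by
      rw [Finset.sum_sub_distrib, ← Finset.mul_sum, ← Complex.ofReal_sum, h.row i]; simp
    rw [e]
    refine (norm_sum_le_of_le _ fun j _ => h.norm_mgfDev_sub_le_sq hB hKM hz i j).trans ?_
    rw [← Finset.mul_sum]
    gcongr
    exact row_sum_sq_le_lyapGamma i
  · intro j
    simp only [add_sub_cancel_left]
    have e : ∑ i, mgfDev X μ z i j = ∑ i, (mgfDev X μ z i j -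
        z / √(normB X μ) * ((∫ ω, X i j ω ∂μ : ℝ) : ℂ)) := by
      rw [Finset.sum_sub_distrib, ← Finset.mul_sum, ← Complex.ofReal_sum, h.col j]; simp
    rw [e]
    refine (norm_sum_le_of_le _ fun i _ => h.norm_mgfDev_sub_le_sq hB hKM hz i j).trans ?_
    rw [← Finset.mul_sum]
    gcongr
    exact col_sum_sq_le_lyapGamma j
  · intro i
    simp only [add_sub_cancel_left]
    refine (Finset.sum_le_sum fun j _ => h.norm_mgfDev_le_abs hB hKM hz i j).trans ?_
    rw [← Finset.mul_sum]
    gcongr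
    exact hcs _ ((Finset.sum_le_sum fun j _ => hsq i j).trans (row_sum_sq_le_lyapGamma i))
  · intro j
    simp only [add_sub_cancel_left]
    refine (Finset.sum_le_sum fun i _ => h.norm_mgfDev_le_abs hB hKM hz i j).trans ?_
    rw [← Finset.mul_sum]
    gcongr
    exact hcs _ ((Finset.sum_le_sum fun i _ => hsq i j).trans (col_sum_sq_le_lyapGamma j))

/-- Cauchy–Schwarz over all `n²` entries at once; the normalised second moments add up to exactly
`n`, so no factor of `lyapGamma` is lost. -/
lemma IsBernsteinArray.sum_norm_mgfDev_le (hn : 4 ≤ n) (hK : 1 ≤ K) :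
    ∑ i, ∑ j, ‖mgfDev X μ z i j‖ ≤ n * (2 * D * K * √n) := by
  have hD := h.D_pos
  have hb : 0 < √(normB X μ) := Real.sqrt_pos.2 hB
  have hsq : ∀ i j, ((∫ ω, |X i j ω| ∂μ) / √(normB X μ)) ^ 2 ≤
      (∫ ω, X i j ω ^ 2 ∂μ) / normB X μ := fun i j => by
    rw [div_pow, Real.sq_sqrt hB.le]
    gcongr
    exact h.sq_integral_abs_le i j
  have h1 : ∑ p : Fin n × Fin n, (∫ ω, |X p.1 p.2 ω| ∂μ) / √(normB X μ) ≤ n * √n := by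
    refine le_of_sq_le_sq ?_ (by positivity)
    refine (sq_sum_le_card_mul_sum_sq).trans ?_
    rw [Finset.card_univ, Fintype.card_prod, Fintype.card_fin, mul_pow,
      Real.sq_sqrt (by positivity)]
    calc _ ≤ ((n * n : ℕ) : ℝ) * ∑ p : Fin n × Fin n, (∫ ω, X p.1 p.2 ω ^ 2 ∂μ) / normB X μ := by
          gcongr with p; exact hsq p.1 p.2
      _ = _ := by
          rw [Fintype.sum_prod_type, sum_sq_div_normB (by omega) hB]; push_cast; ring
  calc _ ≤ ∑ i, ∑ j, 2 * D * K * ((∫ ω, |X i j ω| ∂μ) / √(normB X μ)) :=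
        Finset.sum_le_sum fun i _ => Finset.sum_le_sum fun j _ =>
          h.norm_mgfDev_le_abs hB hKM hz i j
    _ = 2 * D * K * ∑ p : Fin n × Fin n, (∫ ω, |X p.1 p.2 ω| ∂μ) / √(normB X μ) := by
        rw [Fintype.sum_prod_type]; simp only [Finset.mul_sum]
    _ ≤ 2 * D * K * (n * √n) := by gcongr
    _ = _ := by ring

/-- Third-order expansion: the linear terms sum to zero, the quadratic ones to `n z² / 2`, and the
remainder is the Lyapunov sum of third moments. -/
lemma IsBernsteinArray.norm_sum_mgfDev_div_sub_le (hn : 4 ≤ n) (hK : 1 ≤ K) :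
    ‖(∑ i, ∑ j, mgfDev X μ z i j) / n - z ^ 2 / 2‖ ≤
      2 * D * (K ^ 3 * lyapGamma X μ / √n) := by
  have hD := h.D_pos
  have hnpos : (0 : ℝ) < n := by exact_mod_cast (by omega : 0 < n)
  have hnC : (n : ℂ) ≠ 0 := by exact_mod_cast hnpos.ne'
  have hn0 : 0 < √(n : ℝ) := Real.sqrt_pos.2 hnpos
  have e : (∑ i, ∑ j, mgfDev X μ z i j) / n - z ^ 2 / 2 = (∑ i, ∑ j, (mgfDev X μ z i j -
      z / √(normB X μ) * ((∫ ω, X i j ω ∂μ : ℝ) : ℂ) -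
      z ^ 2 / 2 * (((∫ ω, X i j ω ^ 2 ∂μ) / normB X μ : ℝ) : ℂ))) / n := by
    simp only [Finset.sum_sub_distrib, ← Finset.mul_sum, ← Complex.ofReal_sum, h.row,
      sum_sq_div_normB (X := X) (μ := μ) (by omega) hB]
    simp
    field_simp
  rw [e, norm_div, Complex.norm_natCast, div_le_iff₀ hnpos]
  refine (norm_sum_le_of_le _ fun i _ => norm_sum_le_of_le _ fun j _ =>
    h.norm_mgfDev_sub_le_cube hB hKM hz i j).trans ?_
  have h1 := sum_cube_le_lyapGamma (X := X) (μ := μ)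
  simp only [← Finset.mul_sum]
  have h2 : ∑ i, ∑ j, (∫ ω, |X i j ω| ^ 3 ∂μ) / normB X μ ^ (3 / 2 : ℝ) ≤ √n * lyapGamma X μ := by
    refine le_trans (le_of_eq ?_) (mul_le_mul_of_nonneg_left h1 hn0.le)
    simp only [Finset.mul_sum]
    refine Finset.sum_congr rfl fun i _ => Finset.sum_congr rfl fun j _ => ?_
    field_simp
  calc _ ≤ 2 * D * K ^ 3 * (√n * lyapGamma X μ) := by gcongr
    _ = 2 * D * (K ^ 3 * lyapGamma X μ / √n) * (√n * √n) := by field_simp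
    _ = _ := by rw [Real.mul_self_sqrt hnpos.le]

theorem IsBernsteinArray.norm_integral_cexp_combSum_sub_le {π : Ω → Equiv.Perm (Fin n)}
    (hn : 4 ≤ n) (hK : 1 ≤ K)
    (hind : iIndepFun (fun (p : Fin n × Fin n) => X p.1 p.2) μ) (hπ : IsUniformPerm π μ)
    (hπX : IndepFun π (fun ω i j => X i j ω) μ) {q : ℝ}
    (hq : q = K ^ 3 * lyapGamma X μ / √n) (hq1 : q ≤ 1) (hDq : 2 * D * q ≤ 1 / 100) :
    ‖∫ ω, Complex.exp (z * (combSum X π ω / √(normB X μ) : ℝ)) ∂μ - Complex.exp (z ^ 2 / 2)‖ ≤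
      mgfError D q * ‖Complex.exp (z ^ 2 / 2)‖ := by
  have hD := h.D_pos
  have hnpos : (0 : ℝ) < n := by exact_mod_cast (by omega : 0 < n)
  have hn0 : 0 < √(n : ℝ) := Real.sqrt_pos.2 hnpos
  have hn1 : 1 ≤ √(n : ℝ) := Real.one_le_sqrt.2 (by exact_mod_cast (by omega : 1 ≤ n))
  have hnn : √(n : ℝ) * √n = n := Real.mul_self_sqrt hnpos.le
  set γ := lyapGamma X μ with hγ
  have hγ1 : 1 ≤ γ := one_le_lyapGamma (by omega) hB
  have hK3 : K ≤ K ^ 3 := le_self_pow₀ hK (by norm_num)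
  have hKγ : K * (γ / √n) ≤ q := by
    rw [hq, mul_div_assoc]; gcongr
  have hq0 : 0 ≤ q := by rw [hq]; positivity
  have hKn : K ≤ √n := by
    have h1 : K * γ / √n ≤ 1 := by rw [mul_div_assoc]; exact hKγ.trans hq1
    rw [div_le_one hn0] at h1
    nlinarith
  have hsγ : √γ ≤ γ := by
    rw [Real.sqrt_le_iff]; constructor <;> nlinarith
  have hδ : 2 * D * K * (γ / √n) ≤ 1 / 100 := by
    calc _ = 2 * D * (K * (γ / √n)) := by ring
      _ ≤ 2 * D * q := by gcongr
      _ ≤ _ := hDq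
  have hγn : γ / √n ≤ γ := div_le_self (by linarith) hn1
  have hnγ : n * (γ / √n) = √n * γ := by
    rw [mul_div_assoc', div_eq_iff hn0.ne']
    linear_combination (-γ) * hnn
  set ε := 424 * D ^ 2 * q + 32768 * D ^ 4 * q ^ 2 with hε
  have hε0 : 0 ≤ ε := by positivity
  set T := ∑ i, ∑ j, mgfDev X μ z i j with hT
  have hper := norm_sum_perm_prod_sub_le (h.isNearOne hB hKM hz hn hK) (n := n)
    (L := 2 * D * K * √n) (ε := ε) (by positivity) hδ
    (by
      calc 2 * D * K * (γ / √n) ≤ 2 * D * K * γ := by gcongr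
        _ ≤ 2 * D * K ^ 2 * γ := by
          gcongr; exact le_self_pow₀ hK (by norm_num))
    (by positivity) (Fintype.card_fin n) hn
    (by
      calc 2 * D * K * (√n * √γ) ≤ 2 * D * K * (√n * γ) := by gcongr
        _ = n * (2 * D * K * (γ / √n)) := by rw [← hnγ]; ring)
    (by
      calc 2 * D * K ^ 2 * γ = 2 * D * K * (K * γ) := by ring
        _ ≤ 2 * D * K * (√n * γ) := by gcongr
        _ = n * (2 * D * K * (γ / √n)) := by rw [← hnγ]; ring)
    (h.sum_norm_mgfDev_le hB hKM hz hn hK)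
    (by
      -- The `ρ` part of the error is exactly of order `q`; the other part is of order `K⁴ γ² / n`,
      -- at most `q²` since `K ≥ 1`.
      have e1 : 2 * D * K * √n * (106 * (2 * D * K ^ 2 * γ) / n) = 424 * D ^ 2 * q := by
        rw [hq, ← hnn]; field_simp; norm_num; ring
      have e2 : 2 * D * K * √n * (2048 * (2 * D * K * (√n * √γ) / n) ^ 2 *
          (2 * D * K * (γ / √n))) = 32768 * D ^ 4 * (K ^ 4 * γ ^ 2 / n) := by
        rw [div_pow, mul_pow (2 * D * K), mul_pow √(n : ℝ), Real.sq_sqrt hnpos.le,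
          Real.sq_sqrt (zero_le_one.trans hγ1)]
        field_simp
        ring
      have e3 : K ^ 4 * γ ^ 2 / n ≤ q ^ 2 := by
        rw [hq, div_pow, mul_pow, Real.sq_sqrt hnpos.le, ← pow_mul]
        have := pow_le_pow_right₀ hK (show 4 ≤ 3 * 2 by norm_num)
        gcongr ?_ * _ / _
      rw [mul_add, e1, e2]
      exact add_le_add le_rfl (mul_le_mul_of_nonneg_left e3 (by positivity)))
  have hdiff := h.norm_sum_mgfDev_div_sub_le hB hKM hz hn hK
  rw [← hT] at hper hdiff
  rw [← hq] at hdiff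
  have hint : ∫ ω, Complex.exp (z * (combSum X π ω / √(normB X μ) : ℝ)) ∂μ =
      (n ! : ℂ)⁻¹ * ∑ σ : Equiv.Perm (Fin n), ∏ i, (1 + mgfDev X μ z i (σ i)) := by
    have h1 := integral_cexp_combSum h.meas hind hπ hπX (z := z / √(normB X μ))
      (h.integrable_exp_div hB hKM hz)
    simp only [mgfDev, add_sub_cancel]
    rw [← h1]
    congr 1; funext ω; congr 1; push_cast; ring
  set E := ∫ ω, Complex.exp (z * (combSum X π ω / √(normB X μ) : ℝ)) ∂μ with hE
  have hfac : (0 : ℝ) < (n ! : ℝ) := by positivity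
  have hfacC : (n ! : ℂ) ≠ 0 := by exact_mod_cast hfac.ne'
  have hx : ‖E * Complex.exp (-T / n) - 1‖ ≤ ε * Real.exp ε := by
    have e : E * Complex.exp (-T / n) - 1 = (n ! : ℂ)⁻¹ *
        ((∑ σ : Equiv.Perm (Fin n), ∏ i, (1 + mgfDev X μ z i (σ i))) * Complex.exp (-T / n) -
          (n ! : ℂ)) := by
      rw [hint]; field_simp
    rw [e, norm_mul, norm_inv, Complex.norm_natCast, inv_mul_le_iff₀ hfac]
    exact hper
  have hv1 : ‖T / n - z ^ 2 / 2‖ ≤ 1 := hdiff.trans (hDq.trans (by norm_num))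
  have hy : ‖Complex.exp (T / n - z ^ 2 / 2) - 1‖ ≤ 4 * D * q := by
    refine (Complex.norm_exp_sub_one_le hv1).trans ?_
    linarith
  -- With `1 + x = E exp (-T / n)` and `1 + y = exp (T / n - z² / 2)`, the relative error is `(1 +
  -- x) (1 + y) - 1 = x (1 + y) + y`, whence the shape of `mgfError`.
  have e : E - Complex.exp (z ^ 2 / 2) = ((E * Complex.exp (-T / n) - 1) *
      (1 + (Complex.exp (T / n - z ^ 2 / 2) - 1)) + (Complex.exp (T / n - z ^ 2 / 2) - 1)) *
        Complex.exp (z ^ 2 / 2) := by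
    have h1 : Complex.exp (-T / n) * Complex.exp (T / n - z ^ 2 / 2) * Complex.exp (z ^ 2 / 2) =
        1 := by
      rw [← Complex.exp_add, ← Complex.exp_add, ← Complex.exp_zero]
      congr 1; ring
    linear_combination E * (-h1)
  rw [e, norm_mul]
  gcongr
  refine (norm_add_le _ _).trans ?_
  rw [norm_mul]
  simp only [mgfError, ← hε]
  gcongr
  refine (norm_add_le _ _).trans ?_
  rw [norm_one]
  linarith

end Estimates

end BernsteinArray

/-! ### A positive integrable weight with compactly supported Fourier transform. -/

section Kernel

/-- The triangular function supported in `[-1, 1]`. -/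
noncomputable def triangle (s : ℝ) : ℝ := max (1 - |s|) 0

lemma continuous_triangle : Continuous triangle := by unfold triangle; fun_prop

lemma triangle_nonneg (s : ℝ) : 0 ≤ triangle s := le_max_right _ _

lemma triangle_le_one (s : ℝ) : triangle s ≤ 1 :=
  max_le (by linarith [abs_nonneg s]) zero_le_one

lemma triangle_eq_zero {s : ℝ} (hs : 1 ≤ |s|) : triangle s = 0 := max_eq_right (by linarith)

lemma hasCompactSupport_triangle : HasCompactSupport triangle :=
  HasCompactSupport.intro (isCompact_Icc (a := (-1 : ℝ)) (b := 1)) fun x hx => by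
    refine triangle_eq_zero ?_
    by_contra h
    exact hx (abs_le.1 (by linarith))

lemma integral_one_sub_mul_cexp {a : ℂ} (ha : a ≠ 0) :
    ∫ s in (0 : ℝ)..1, (1 - (s : ℂ)) * Complex.exp (a * s) =
      Complex.exp a / a ^ 2 - 1 / a - 1 / a ^ 2 := by
  have hd : ∀ s : ℝ, HasDerivAt (fun s : ℝ => (1 - (s : ℂ)) * Complex.exp (a * s) / a +
      Complex.exp (a * s) / a ^ 2) ((1 - (s : ℂ)) * Complex.exp (a * s)) s := by
    intro s
    have h1 : HasDerivAt (fun s : ℝ => (s : ℂ)) 1 s := Complex.ofRealCLM.hasDerivAt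
    have h2 : HasDerivAt (fun s : ℝ => Complex.exp (a * s)) (Complex.exp (a * s) * (a * 1)) s :=
      (h1.const_mul a).cexp
    have h3 := (((h1.const_sub 1).mul h2).div_const a).add (h2.div_const (a ^ 2))
    refine h3.congr_deriv ?_
    field_simp
    ring
  rw [intervalIntegral.integral_eq_sub_of_hasDerivAt (fun s _ => hd s)
    (by apply Continuous.intervalIntegrable; fun_prop)]
  simp
  ring

lemma integral_triangle_mul_cexp (c : ℝ) :
    ∫ s, (triangle s : ℂ) * Complex.exp (c * Complex.I * s) = ((Real.sinc (c / 2) ^ 2 : ℝ) : ℂ) := by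
  set f : ℝ → ℂ := fun s => (triangle s : ℂ) * Complex.exp (c * Complex.I * s) with hf
  have hcont : Continuous f := by
    have := continuous_triangle
    fun_prop
  have h1 : ∫ s, f s = ∫ s in (-1 : ℝ)..1, f s := by
    rw [intervalIntegral.integral_of_le (by norm_num), ← integral_indicator measurableSet_Ioc]
    congr 1; funext s
    by_cases hs : s ∈ Set.Ioc (-1 : ℝ) 1
    · rw [Set.indicator_of_mem hs]
    · rw [Set.indicator_of_notMem hs]
      have : triangle s = 0 := triangle_eq_zero (by
        by_contra h
        rw [not_le, abs_lt] at h
        exact hs ⟨h.1, h.2.le⟩)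
      simp [hf, this]
  have h2 : ∫ s in (-1 : ℝ)..0, f s = ∫ s in (0 : ℝ)..1, f (-s) := by
    rw [intervalIntegral.integral_comp_neg]; simp
  have h3 : ∫ s in (0 : ℝ)..1, f s =
      ∫ s in (0 : ℝ)..1, (1 - (s : ℂ)) * Complex.exp (c * Complex.I * s) := by
    refine intervalIntegral.integral_congr fun s hs => ?_
    rw [Set.uIcc_of_le zero_le_one] at hs
    have : triangle s = 1 - s := by
      rw [triangle, abs_of_nonneg hs.1, max_eq_left (by linarith [hs.2])]
    simp [hf, this]
  have h4 : ∫ s in (0 : ℝ)..1, f (-s) =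
      ∫ s in (0 : ℝ)..1, (1 - (s : ℂ)) * Complex.exp (-(c * Complex.I) * s) := by
    refine intervalIntegral.integral_congr fun s hs => ?_
    rw [Set.uIcc_of_le zero_le_one] at hs
    have : triangle (-s) = 1 - s := by
      rw [triangle, abs_neg, abs_of_nonneg hs.1, max_eq_left (by linarith [hs.2])]
    simp [hf, this]
  rw [h1, ← intervalIntegral.integral_add_adjacent_intervals (b := 0)
    (hcont.intervalIntegrable _ _) (hcont.intervalIntegrable _ _), h2, h3, h4]
  rcases eq_or_ne c 0 with rfl | hc
  · have h5 : ∫ s in (0 : ℝ)..1, (1 - (s : ℂ)) = 1 / 2 := by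
      have : (fun s : ℝ => (1 - (s : ℂ))) = fun s : ℝ => ((1 - s : ℝ) : ℂ) := by
        funext s; push_cast; ring
      rw [this, intervalIntegral.integral_ofReal]
      rw [intervalIntegral.integral_sub (by simp) (by simp), integral_id]
      norm_num
    simp [h5]
    norm_num
  · have hcC : (c : ℂ) ≠ 0 := by exact_mod_cast hc
    have ha : (c : ℂ) * Complex.I ≠ 0 := mul_ne_zero hcC Complex.I_ne_zero
    rw [integral_one_sub_mul_cexp ha, integral_one_sub_mul_cexp (neg_ne_zero.2 ha),
      Real.sinc_of_ne_zero (by positivity)]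
    have h6 : Complex.exp (c * Complex.I) + Complex.exp (-(c * Complex.I)) =
        2 - 4 * (Complex.sin (c / 2)) ^ 2 := by
      have h7 := Complex.two_cos (x := (c : ℂ))
      rw [← neg_mul, ← h7]
      have : (c : ℂ) = 2 * (c / 2) := by ring
      conv_lhs => rw [this, Complex.cos_two_mul, Complex.cos_sq']
      ring
    have h8 : ((c : ℂ) * Complex.I) ^ 2 = -c ^ 2 := by
      rw [mul_pow, Complex.I_sq]; ring
    have h9 : (-((c : ℂ) * Complex.I)) ^ 2 = -c ^ 2 := by rw [neg_sq, h8]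
    rw [h8, h9]
    push_cast
    have e : Complex.exp (-(c * Complex.I)) =
      2 - 4 * (Complex.sin (c / 2)) ^ 2 - Complex.exp (c * Complex.I) := by rw [← h6]; ring
    rw [e]
    field_simp
    ring

/-- A continuous, compactly supported function with positive Fourier transform. -/
noncomputable def smoother (s : ℝ) : ℂ := triangle s * (1 + Complex.exp (-(Real.pi * Complex.I * s)))

/-- The Fourier transform of `smoother`. -/
noncomputable def smootherHat (v : ℝ) : ℝ :=
  Real.sinc (Real.pi * v) ^ 2 + Real.sinc (Real.pi * v + Real.pi / 2) ^ 2

lemma continuous_smoother : Continuous smoother := by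
  have := continuous_triangle
  unfold smoother; fun_prop

lemma norm_smoother_le (s : ℝ) : ‖smoother s‖ ≤ 2 := by
  rw [smoother, norm_mul, Complex.norm_real, Real.norm_of_nonneg (triangle_nonneg s)]
  have h1 : ‖(1 : ℂ) + Complex.exp (-(Real.pi * Complex.I * s))‖ ≤ 2 := by
    refine (norm_add_le _ _).trans ?_
    have : -(Real.pi * Complex.I * s) = ((-(Real.pi * s) : ℝ) : ℂ) * Complex.I := by
      push_cast; ring
    rw [this, Complex.norm_exp_ofReal_mul_I, norm_one]
    norm_num
  calc _ ≤ 1 * 2 := mul_le_mul (triangle_le_one s) h1 (norm_nonneg _) zero_le_one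
    _ = 2 := by norm_num

lemma smoother_eq_zero {s : ℝ} (hs : 1 ≤ |s|) : smoother s = 0 := by
  simp [smoother, triangle_eq_zero hs]

lemma smoother_zero : smoother 0 = 2 := by
  simp [smoother, triangle]; norm_num

lemma integrable_smoother : Integrable smoother := by
  refine continuous_smoother.integrable_of_hasCompactSupport ?_
  exact HasCompactSupport.intro (isCompact_Icc (a := (-1 : ℝ)) (b := 1)) fun x hx => by
    refine smoother_eq_zero ?_
    by_contra h
    exact hx (abs_le.1 (by linarith))

lemma integral_smoother_mul_cexp (v : ℝ) :
    ∫ s, smoother s * Complex.exp (-(2 * Real.pi * Complex.I * v * s)) = smootherHat v := by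
  have hint : ∀ c : ℝ, Integrable fun s => (triangle s : ℂ) * Complex.exp (c * Complex.I * s) := by
    intro c
    refine Continuous.integrable_of_hasCompactSupport ?_ ?_
    · have := continuous_triangle
      fun_prop
    · exact (hasCompactSupport_triangle.comp_left (g := fun x : ℝ => (x : ℂ)) rfl).mul_right
  have e : ∀ s : ℝ, smoother s * Complex.exp (-(2 * Real.pi * Complex.I * v * s)) =
      (triangle s : ℂ) * Complex.exp ((-(2 * Real.pi * v) : ℝ) * Complex.I * s) +
      (triangle s : ℂ) * Complex.exp ((-(2 * Real.pi * v + Real.pi) : ℝ) * Complex.I * s) := by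
    intro s
    rw [smoother, mul_add, mul_one, add_mul, mul_assoc _ (Complex.exp _), ← Complex.exp_add]
    congr 3 <;> · push_cast; ring_nf
  simp_rw [e]
  rw [integral_add (hint _) (hint _), integral_triangle_mul_cexp, integral_triangle_mul_cexp,
    ← Complex.ofReal_add, smootherHat]
  congr 3
  · rw [← Real.sinc_neg]; congr 2; ring
  · rw [← Real.sinc_neg]; congr 2; ring

lemma continuous_smootherHat : Continuous smootherHat := by
  have := Real.continuous_sinc
  unfold smootherHat; fun_prop

lemma sinc_mul_self (x : ℝ) : Real.sinc x * x = Real.sin x := by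
  rcases eq_or_ne x 0 with rfl | hx
  · simp
  · rw [Real.sinc_of_ne_zero hx, div_mul_cancel₀ _ hx]

lemma sin_sq_le_sinc_sq_mul {x c : ℝ} (hx : |x| ≤ c) : Real.sin x ^ 2 ≤ Real.sinc x ^ 2 * c ^ 2 := by
  rw [← sinc_mul_self, mul_pow]
  exact mul_le_mul_of_nonneg_left
    (sq_le_sq' (by linarith [neg_abs_le x]) ((le_abs_self x).trans hx)) (sq_nonneg _)

/-- A single squared `sinc` has zeros. The shift by `π / 2` turns the second sine into a cosine, so
`sin² + cos² = 1` gives positivity and at most quadratic decay. -/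
lemma one_le_smootherHat_mul (v : ℝ) : 1 ≤ smootherHat v * (Real.pi * (|v| + 1)) ^ 2 := by
  have hpi := Real.pi_pos
  have h1 : |Real.pi * v| ≤ Real.pi * (|v| + 1) := by
    rw [abs_mul, abs_of_pos hpi]; gcongr; linarith
  have h2 : |Real.pi * v + Real.pi / 2| ≤ Real.pi * (|v| + 1) := by
    refine (abs_add_le _ _).trans ?_
    rw [abs_mul, abs_of_pos hpi, abs_of_pos (half_pos hpi)]
    linarith
  have h3 := sin_sq_le_sinc_sq_mul h1
  have h4 := sin_sq_le_sinc_sq_mul h2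
  rw [Real.sin_add_pi_div_two] at h4
  rw [smootherHat, add_mul]
  linarith [Real.sin_sq_add_cos_sq (Real.pi * v)]

lemma smootherHat_pos (v : ℝ) : 0 < smootherHat v := by
  have h1 := one_le_smootherHat_mul v
  by_contra h
  have : smootherHat v * (Real.pi * (|v| + 1)) ^ 2 ≤ 0 :=
    mul_nonpos_of_nonpos_of_nonneg (not_lt.1 h) (by positivity)
  linarith

lemma smootherHat_le_two (v : ℝ) : smootherHat v ≤ 2 := by
  have h : ∀ x, Real.sinc x ^ 2 ≤ 1 := fun x => by
    rw [sq_le_one_iff_abs_le_one]; exact Real.abs_sinc_le_one x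
  rw [smootherHat]; linarith [h (Real.pi * v), h (Real.pi * v + Real.pi / 2)]

lemma integrable_smootherHat : Integrable smootherHat := by
  have h1 : Integrable fun x => Real.sinc x ^ 2 := by
    refine (integrable_inv_one_add_sq.const_mul 2).mono'
      (Real.continuous_sinc.pow 2).aestronglyMeasurable (Eventually.of_forall fun x => ?_)
    rw [Real.norm_of_nonneg (by positivity), ← div_eq_mul_inv, le_div_iff₀ (by positivity), mul_add,
      ← mul_pow, sinc_mul_self]
    have h2 : Real.sinc x ^ 2 ≤ 1 := by
      rw [sq_le_one_iff_abs_le_one]; exact Real.abs_sinc_le_one x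
    linarith [Real.sin_sq_le_one x]
  have h2 : Integrable fun v => Real.sinc (Real.pi * v) ^ 2 := h1.comp_mul_left' Real.pi_ne_zero
  have h3 : Integrable fun v => Real.sinc (Real.pi * v + Real.pi / 2) ^ 2 :=
    (h1.comp_add_right (Real.pi / 2)).comp_mul_left' Real.pi_ne_zero
  exact h2.add h3

-- Fourier inversion, available because `smoother` is continuous and both it and its transform are
-- integrable.
open FourierTransform in
lemma integral_smootherHat_mul_cexp (t : ℝ) :
    ∫ v, (smootherHat v : ℂ) * Complex.exp (2 * Real.pi * Complex.I * t * v) = smoother t := by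
  have h1 : 𝓕 smoother = fun v => (smootherHat v : ℂ) := by
    funext v
    rw [Real.fourier_eq', ← integral_smoother_mul_cexp]
    congr 1; funext s
    rw [smul_eq_mul, mul_comm]
    congr 2
    simp
    ring
  have h2 := congrFun (continuous_smoother.fourierInv_fourier_eq integrable_smoother
    (by rw [h1]; exact integrable_smootherHat.ofReal)) t
  rw [h1, Real.fourierInv_eq'] at h2
  rw [← h2]
  congr 1; funext s
  rw [smul_eq_mul, mul_comm]
  congr 2
  simp
  ring

end Kernel

/-! ### Weak convergence of weighted integrals over continuity sets. -/

section WeakConvergence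

open Topology BoundedContinuousFunction

lemma integral_tilted_log {α : Type*} [MeasurableSpace α] {μ : Measure α} {E : Type*}
    [NormedAddCommGroup E] [NormedSpace ℝ E] {f : α → ℝ} (hf : ∀ x, 0 < f x) (g : α → E) :
    ∫ x, g x ∂(μ.tilted fun x => Real.log (f x)) = (∫ x, f x ∂μ)⁻¹ • ∫ x, f x • g x ∂μ := by
  rw [integral_tilted, ← integral_smul]
  simp only [fun x => Real.exp_log (hf x), smul_smul]
  congr 1; funext x; congr 1; ring

lemma isProbabilityMeasure_tilted_log {α : Type*} [MeasurableSpace α] {μ : Measure α} [NeZero μ]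
    {f : α → ℝ} (hf : ∀ x, 0 < f x) (hint : Integrable f μ) :
    IsProbabilityMeasure (μ.tilted fun x => Real.log (f x)) := by
  refine isProbabilityMeasure_tilted ?_
  simpa only [fun x => Real.exp_log (hf x)] using hint

/-- Reweighting by `H` and normalising preserves weak convergence, so the portmanteau theorem for
the reweighted laws gives the claim. -/
lemma tendsto_setIntegral_of_tendsto {p : ℕ → ProbabilityMeasure ℝ} {p₀ : ProbabilityMeasure ℝ}
    (hp : Tendsto p atTop (𝓝 p₀)) (H : ℝ →ᵇ ℝ) (hH : ∀ x, 0 < H x) {A : Set ℝ}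
    (hA : MeasurableSet A) (hA0 : (p₀ : Measure ℝ) (frontier A) = 0) :
    Tendsto (fun n => ∫ x in A, H x ∂(p n : Measure ℝ)) atTop
      (𝓝 (∫ x in A, H x ∂(p₀ : Measure ℝ))) := by
  have hint : ∀ q : ProbabilityMeasure ℝ, Integrable H (q : Measure ℝ) := fun q => H.integrable _
  have hpos : ∀ q : ProbabilityMeasure ℝ, 0 < ∫ x, H x ∂(q : Measure ℝ) := fun q => by
    rw [integral_pos_iff_support_of_nonneg (fun x => (hH x).le) (hint q)]
    rw [show Function.support H = Set.univ from Set.eq_univ_of_forall fun x => (hH x).ne']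
    simp
  let T : ProbabilityMeasure ℝ → ProbabilityMeasure ℝ := fun q =>
    ⟨(q : Measure ℝ).tilted fun x => Real.log (H x), isProbabilityMeasure_tilted_log hH (hint q)⟩
  have hTi : ∀ (q : ProbabilityMeasure ℝ) (g : ℝ → ℝ), ∫ x, g x ∂(T q : Measure ℝ) =
      (∫ x, H x ∂(q : Measure ℝ))⁻¹ * ∫ x, H x * g x ∂(q : Measure ℝ) := fun q g =>
    integral_tilted_log hH g
  have hconv := ProbabilityMeasure.tendsto_iff_forall_integral_tendsto.1 hp
  have hT : Tendsto (fun n => T (p n)) atTop (𝓝 (T p₀)) := by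
    rw [ProbabilityMeasure.tendsto_iff_forall_integral_tendsto]
    intro g
    simp_rw [hTi]
    exact ((hconv H).inv₀ (hpos p₀).ne').mul (hconv (H * g))
  have hfr : (T p₀ : Measure ℝ) (frontier A) = 0 := tilted_absolutelyContinuous _ _ hA0
  have hport := ProbabilityMeasure.tendsto_measure_of_null_frontier_of_tendsto' hT hfr
  have hreal := (ENNReal.tendsto_toReal (measure_ne_top _ A)).comp hport
  have hset : ∀ q : ProbabilityMeasure ℝ, ∫ x in A, H x ∂(q : Measure ℝ) =
      (∫ x, H x ∂(q : Measure ℝ)) * ((T q : Measure ℝ) A).toReal := fun q => by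
    have h1 := hTi q (A.indicator 1)
    rw [integral_indicator_one hA] at h1
    rw [← measureReal_def, h1, ← mul_assoc, mul_inv_cancel₀ (hpos q).ne', one_mul,
      ← integral_indicator hA]
    congr 1; funext x
    by_cases hx : x ∈ A <;> simp [hx]
  simp_rw [hset]
  exact (hconv H).mul hreal

end WeakConvergence

/-! ### Exponential tilting and the smoothed Fourier transform. -/

section Tilt

open Topology

/-- The normalised Fourier transform of `m` tilted by `exp (u w)`, in the variable `u (w - u)`. -/
noncomputable def tiltFourier (m : Measure ℝ) (u θ : ℝ) : ℂ :=
  ∫ w : ℝ, Complex.exp ((u * w - u ^ 2 / 2 : ℝ) + θ * (u * (w - u) : ℝ) * Complex.I) ∂m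

lemma stronglyMeasurable_tiltFourier (m : Measure ℝ) [SFinite m] (u : ℝ) :
    StronglyMeasurable (tiltFourier m u) := by
  unfold tiltFourier
  have h : Continuous (Function.uncurry fun (θ w : ℝ) =>
    Complex.exp ((u * w - u ^ 2 / 2 : ℝ) + θ * (u * (w - u) : ℝ) * Complex.I)) := by
    unfold Function.uncurry; fun_prop
  exact h.stronglyMeasurable.integral_prod_right

/-- Write the weight as the Fourier integral of `smoother` and apply Fubini. On the right, compact
support restricts the transform to arguments of size at most `2 π (|t| + 1)`. -/
lemma integral_smootherHat_tilt {m : Measure ℝ} [IsProbabilityMeasure m] {u : ℝ}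
    (hint : Integrable (fun w => Real.exp (u * w)) m) (t : ℝ) :
    ∫ w, ((Real.exp (u * w - u ^ 2 / 2) * smootherHat (u * (w - u)) : ℝ) : ℂ) *
      Complex.exp (2 * Real.pi * Complex.I * t * (u * (w - u) : ℝ)) ∂m =
    ∫ s, smoother s * tiltFourier m u (2 * Real.pi * (t - s)) := by
  have hint' : Integrable (fun w => Real.exp (u * w - u ^ 2 / 2)) m := by
    simp_rw [Real.exp_sub]; exact hint.div_const _
  have h1 : ∀ w s : ℝ, (Real.exp (u * w - u ^ 2 / 2) : ℂ) *
      (smoother s * Complex.exp (-(2 * Real.pi * Complex.I * (u * (w - u) : ℝ) * s))) *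
      Complex.exp (2 * Real.pi * Complex.I * t * (u * (w - u) : ℝ)) =
      smoother s * Complex.exp ((u * w - u ^ 2 / 2 : ℝ) +
        (2 * Real.pi * (t - s) : ℝ) * (u * (w - u) : ℝ) * Complex.I) := by
    intro w s
    rw [Complex.ofReal_exp, mul_left_comm, mul_assoc, ← Complex.exp_add, ← Complex.exp_add]
    congr 2
    push_cast; ring
  have h2 : ∀ w : ℝ, ((Real.exp (u * w - u ^ 2 / 2) * smootherHat (u * (w - u)) : ℝ) : ℂ) *
      Complex.exp (2 * Real.pi * Complex.I * t * (u * (w - u) : ℝ)) =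
      ∫ s, smoother s * Complex.exp ((u * w - u ^ 2 / 2 : ℝ) +
        (2 * Real.pi * (t - s) : ℝ) * (u * (w - u) : ℝ) * Complex.I) := by
    intro w
    simp_rw [← h1]
    rw [integral_mul_const, integral_const_mul, integral_smoother_mul_cexp]
    push_cast; ring
  simp_rw [h2]
  rw [integral_integral_swap]
  · congr 1; funext s
    rw [integral_const_mul, tiltFourier]
  · refine (hint'.mul_prod integrable_smoother.norm).mono' ?_ (Eventually.of_forall fun x => ?_)
    · have := continuous_smoother
      refine Continuous.aestronglyMeasurable ?_
      unfold Function.uncurry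
      fun_prop
    · simp only [Function.uncurry]
      rw [norm_mul, mul_comm, Complex.norm_exp]
      apply le_of_eq
      congr 2
      simp [-Complex.ofReal_pow]

lemma mul_integral_smoother_mul {u : ℝ} (hu : 0 < u) (t : ℝ) (T : ℝ → ℂ) :
    u * ∫ s, smoother s * T (2 * Real.pi * (t - s)) =
      ∫ r, smoother (t - r / u) * T (2 * Real.pi * (r / u)) := by
  have h1 := Measure.integral_comp_div
    (fun x => smoother (t - x) * T (2 * Real.pi * x)) u
  have h2 := integral_sub_left_eq_self (fun s => smoother s * T (2 * Real.pi * (t - s))) volume t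
  rw [h1, ← h2, abs_of_pos hu, Complex.real_smul]
  congr 2; funext x; simp

/-- The transform lives at scale `1 / u`. After the substitution `s = t - r / u` it becomes a fixed
Gaussian in `r`, while `smoother (t - r / u)` tends to `smoother t`; dominated convergence
concludes. -/
lemma tendsto_integral_smoother_mul {u : ℕ → ℝ} (hu : Tendsto u atTop atTop) {T : ℕ → ℝ → ℂ}
    (hTm : ∀ n, StronglyMeasurable (T n))
    (hT : ∀ Θ : ℝ, ∀ ε > 0, ∀ᶠ n in atTop, ∀ θ : ℝ, |θ| ≤ Θ →
      ‖T n θ - (Real.exp (-(θ * u n) ^ 2 / 2) : ℂ)‖ ≤ ε * Real.exp (-(θ * u n) ^ 2 / 2)) (t : ℝ) :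
    Tendsto (fun n => (u n : ℂ) * ∫ s, smoother s * T n (2 * Real.pi * (t - s))) atTop
      (𝓝 (smoother t * ∫ r : ℝ, (Real.exp (-(2 * Real.pi * r) ^ 2 / 2) : ℂ))) := by
  have hu0 : ∀ᶠ n in atTop, 0 < u n := hu.eventually_gt_atTop 0
  rw [← integral_const_mul]
  refine Tendsto.congr' (hu0.mono fun n hn => (mul_integral_smoother_mul hn t (T n)).symm) ?_
  have hgauss : Integrable fun r : ℝ => Real.exp (-(2 * Real.pi * r) ^ 2 / 2) := by
    have := integrable_exp_neg_mul_sq (b := 2 * Real.pi ^ 2) (by positivity)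
    refine this.congr (Eventually.of_forall fun r => ?_)
    simp only; congr 1; ring
  refine tendsto_integral_filter_of_dominated_convergence
    (fun r => 4 * Real.exp (-(2 * Real.pi * r) ^ 2 / 2)) ?_ ?_ (hgauss.const_mul 4) ?_
  · refine Eventually.of_forall fun n => ?_
    have h1 : Continuous fun r : ℝ => smoother (t - r / u n) := by
      have := continuous_smoother
      fun_prop
    exact h1.aestronglyMeasurable.mul ((hTm n).comp_measurable
      (by fun_prop : Measurable fun r : ℝ => 2 * Real.pi * (r / u n))).aestronglyMeasurable
  -- Taking `ε = 1` bounds the transform by twice the Gaussian, and `‖smoother‖ ≤ 2` gives the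
  -- constant `4`.
  · filter_upwards [hu0, hT (2 * Real.pi * (|t| + 1)) 1 one_pos] with n hn hTn
    refine Eventually.of_forall fun r => ?_
    rcases le_or_gt 1 |t - r / u n| with h | h
    · rw [smoother_eq_zero h, zero_mul, norm_zero]; positivity
    · have h1 : |r / u n| ≤ |t| + 1 := by
        have := abs_sub_abs_le_abs_sub (r / u n) t
        rw [abs_sub_comm] at this
        linarith
      have h2 := hTn (2 * Real.pi * (r / u n)) (by
        rw [abs_mul, abs_of_pos (by positivity : 0 < 2 * Real.pi)]
        gcongr)
      have h3 : 2 * Real.pi * (r / u n) * u n = 2 * Real.pi * r := by field_simp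
      rw [h3] at h2
      have h4 := norm_le_norm_sub_add (T n (2 * Real.pi * (r / u n)))
        (Real.exp (-(2 * Real.pi * r) ^ 2 / 2) : ℂ)
      rw [Complex.norm_real, Real.norm_of_nonneg (Real.exp_pos _).le] at h4
      rw [norm_mul]
      calc _ ≤ 2 * (2 * Real.exp (-(2 * Real.pi * r) ^ 2 / 2)) := by
            gcongr
            · exact norm_smoother_le _
            · linarith
        _ = _ := by ring
  · refine Eventually.of_forall fun r => ?_
    have hr : Tendsto (fun n => r / u n) atTop (𝓝 0) := hu.const_div_atTop r
    refine Tendsto.mul ?_ ?_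
    · have := (continuous_smoother.tendsto (t - 0)).comp (tendsto_const_nhds.sub hr)
      rwa [sub_zero] at this
    · rw [Metric.tendsto_nhds]
      intro ε hε
      have hr1 : ∀ᶠ n in atTop, |2 * Real.pi * (r / u n)| ≤ 1 := by
        have : Tendsto (fun n => |2 * Real.pi * (r / u n)|) atTop (𝓝 0) := by
          simpa using (hr.const_mul (2 * Real.pi)).abs
        exact (this.eventually_lt_const one_pos).mono fun n hn => hn.le
      filter_upwards [hu0, hr1, hT 1 (ε / 2) (by positivity)] with n hn h1 h2
      have h3 := h2 _ h1
      have h4 : 2 * Real.pi * (r / u n) * u n = 2 * Real.pi * r := by field_simp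
      rw [h4] at h3
      rw [dist_eq_norm]
      refine h3.trans_lt ?_
      have : Real.exp (-(2 * Real.pi * r) ^ 2 / 2) ≤ 1 :=
        Real.exp_le_one_iff.2 (by nlinarith [sq_nonneg (2 * Real.pi * r)])
      nlinarith

end Tilt

/-! ### Universal tail asymptotics from the transform. -/

section Tail

open Topology BoundedContinuousFunction

/-- The two-sided exponential density relative to `smootherHat`. -/
noncomputable def expRatio : ℝ →ᵇ ℝ :=
  BoundedContinuousFunction.ofNormedAddCommGroup (fun x => Real.exp (-|x|) / smootherHat x)
    (Continuous.div (by fun_prop) continuous_smootherHat fun x => (smootherHat_pos x).ne')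
    (4 * Real.pi ^ 2) fun x => by
      have hk := smootherHat_pos x
      rw [Real.norm_of_nonneg (by positivity), div_le_iff₀ hk]
      have h1 := one_le_smootherHat_mul x
      -- The exponential beats the quadratic decay of `smootherHat`, so the quotient is a bounded
      -- test function.
      have h2 : (|x| + 1) ^ 2 ≤ 4 * Real.exp |x| := by
        have h3 : |x| + 1 ≤ 2 * Real.exp (|x| / 2) := by
          linarith [Real.add_one_le_exp (|x| / 2), abs_nonneg x]
        calc (|x| + 1) ^ 2 ≤ (2 * Real.exp (|x| / 2)) ^ 2 := by gcongr
          _ = 4 * Real.exp |x| := by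
            rw [mul_pow, ← Real.exp_nat_mul]; norm_num; ring_nf
      calc Real.exp (-|x|) ≤
          Real.exp (-|x|) * (smootherHat x * (Real.pi * (|x| + 1)) ^ 2) :=
            le_mul_of_one_le_right (Real.exp_pos _).le h1
        _ = Real.exp (-|x|) * smootherHat x * Real.pi ^ 2 * (|x| + 1) ^ 2 := by ring
        _ ≤ Real.exp (-|x|) * smootherHat x * Real.pi ^ 2 * (4 * Real.exp |x|) := by gcongr
        _ = 4 * Real.pi ^ 2 * smootherHat x * (Real.exp (-|x|) * Real.exp |x|) := by ring
        _ = _ := by rw [← Real.exp_add]; simp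

lemma expRatio_apply (x : ℝ) : expRatio x = Real.exp (-|x|) / smootherHat x := rfl

lemma expRatio_pos (x : ℝ) : 0 < expRatio x := by
  rw [expRatio_apply]; exact div_pos (Real.exp_pos _) (smootherHat_pos x)

/-- The probability measure with density proportional to `smootherHat`. -/
noncomputable def smoothMeasure : ProbabilityMeasure ℝ :=
  ⟨volume.tilted fun x => Real.log (smootherHat x),
    isProbabilityMeasure_tilted_log smootherHat_pos integrable_smootherHat⟩

lemma integral_smootherHat : ∫ x, smootherHat x = 2 := by
  have h := integral_smootherHat_mul_cexp 0
  simp only [Complex.ofReal_zero, mul_zero, zero_mul, Complex.exp_zero, mul_one, smoother_zero] at h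
  rw [integral_complex_ofReal] at h
  exact_mod_cast h

lemma charFun_smoothMeasure (t : ℝ) :
    charFun (smoothMeasure : Measure ℝ) (2 * Real.pi * t) = smoother t / 2 := by
  have h1 : charFun (smoothMeasure : Measure ℝ) (2 * Real.pi * t) =
      ∫ x : ℝ, Complex.exp ((2 * Real.pi * t : ℝ) * x * Complex.I)
        ∂(volume.tilted fun x => Real.log (smootherHat x)) := charFun_apply_real _
  rw [h1, integral_tilted_log smootherHat_pos, integral_smootherHat,
    ← integral_smootherHat_mul_cexp]
  simp only [Complex.real_smul]
  rw [div_eq_inv_mul]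
  push_cast
  congr 2; funext x; congr 2; ring

lemma setIntegral_expRatio_pos : 0 < ∫ x in Set.Ici 0, expRatio x ∂(smoothMeasure : Measure ℝ) := by
  rw [setIntegral_pos_iff_support_of_nonneg_ae
    (Eventually.of_forall fun x => (expRatio_pos x).le) (expRatio.integrable _).integrableOn]
  rw [show Function.support expRatio = Set.univ from
    Set.eq_univ_of_forall fun x => (expRatio_pos x).ne', Set.univ_inter, pos_iff_ne_zero]
  intro h
  have hac : (volume : Measure ℝ) ≪ (smoothMeasure : Measure ℝ) := by
    refine absolutelyContinuous_tilted ?_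
    simpa only [fun x => Real.exp_log (smootherHat_pos x)] using integrable_smootherHat
  have := hac h
  simp at this

/-- The density of `m` tilted by `exp (u w)` and weighted by `smootherHat`. -/
noncomputable def tiltDensity (u w : ℝ) : ℝ :=
  Real.exp (u * w - u ^ 2 / 2) * smootherHat (u * (w - u))

lemma tiltDensity_pos (u w : ℝ) : 0 < tiltDensity u w :=
  mul_pos (Real.exp_pos _) (smootherHat_pos _)

lemma continuous_tiltDensity (u : ℝ) : Continuous (tiltDensity u) := by
  have := continuous_smootherHat
  unfold tiltDensity; fun_prop

variable {m : Measure ℝ} {u : ℝ}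

lemma integrable_tiltDensity (hint : Integrable (fun w => Real.exp (u * w)) m) :
    Integrable (tiltDensity u) m := by
  have hint' : Integrable (fun w => Real.exp (u * w - u ^ 2 / 2)) m := by
    simp_rw [Real.exp_sub]; exact hint.div_const _
  refine (hint'.mul_const 2).mono' (continuous_tiltDensity u).aestronglyMeasurable
    (Eventually.of_forall fun w => ?_)
  rw [Real.norm_of_nonneg (tiltDensity_pos u w).le, tiltDensity]
  gcongr
  exact smootherHat_le_two _

variable [IsProbabilityMeasure m]

/-- The law of `u (w - u)` under `m` with the density `tiltDensity`, normalised. -/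
noncomputable def tiltLaw (hint : Integrable (fun w => Real.exp (u * w)) m) :
    ProbabilityMeasure ℝ :=
  ⟨(m.tilted fun w => Real.log (tiltDensity u w)).map fun w => u * (w - u),
    have := isProbabilityMeasure_tilted_log (tiltDensity_pos u) (integrable_tiltDensity hint)
    Measure.isProbabilityMeasure_map (by fun_prop)⟩

lemma integral_tiltLaw {E : Type*} [NormedAddCommGroup E] [NormedSpace ℝ E]
    (hint : Integrable (fun w => Real.exp (u * w)) m) {g : ℝ → E} (hg : StronglyMeasurable g) :
    ∫ x, g x ∂(tiltLaw hint : Measure ℝ) =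
      (∫ w, tiltDensity u w ∂m)⁻¹ • ∫ w, tiltDensity u w • g (u * (w - u)) ∂m := by
  rw [← integral_tilted_log (tiltDensity_pos u)]
  exact integral_map (by fun_prop) hg.aestronglyMeasurable

lemma charFun_tiltLaw (hu : 0 < u) (hint : Integrable (fun w => Real.exp (u * w)) m) (t : ℝ) :
    charFun (tiltLaw hint : Measure ℝ) (2 * Real.pi * t) =
      ((u * ∫ w, tiltDensity u w ∂m : ℝ) : ℂ)⁻¹ *
        (u * ∫ s, smoother s * tiltFourier m u (2 * Real.pi * (t - s))) := by
  have huC : (u : ℂ) ≠ 0 := by exact_mod_cast hu.ne'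
  rw [charFun_apply_real, integral_tiltLaw hint (by
      apply Continuous.stronglyMeasurable; fun_prop), ← integral_smootherHat_tilt hint t]
  have e : ∀ w : ℝ, tiltDensity u w • Complex.exp ((2 * Real.pi * t : ℝ) * (u * (w - u) : ℝ) *
      Complex.I) = ((Real.exp (u * w - u ^ 2 / 2) * smootherHat (u * (w - u)) : ℝ) : ℂ) *
      Complex.exp (2 * Real.pi * Complex.I * t * (u * (w - u) : ℝ)) := fun w => by
    rw [Complex.real_smul, tiltDensity]
    congr 2
    push_cast; ring
  simp_rw [e]
  rw [Complex.real_smul]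
  push_cast
  rw [mul_inv, mul_mul_mul_comm, inv_mul_cancel₀ huC, one_mul]

/-- On `w ≥ u` the weight cancels and the exponents `-u (w - u)` and `u w - u² / 2` add up to `u² /
2`, leaving the bare tail. -/
lemma setIntegral_expRatio_tiltLaw (hu : 0 < u)
    (hint : Integrable (fun w => Real.exp (u * w)) m) :
    ∫ x in Set.Ici 0, expRatio x ∂(tiltLaw hint : Measure ℝ) =
      (∫ w, tiltDensity u w ∂m)⁻¹ * (Real.exp (u ^ 2 / 2) * m.real (Set.Ici u)) := by
  rw [← integral_indicator measurableSet_Ici, integral_tiltLaw hint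
    (expRatio.continuous.stronglyMeasurable.indicator measurableSet_Ici), smul_eq_mul]
  congr 1
  have e : ∀ w : ℝ, tiltDensity u w • (Set.Ici 0).indicator expRatio (u * (w - u)) =
      (Set.Ici u).indicator (fun _ => Real.exp (u ^ 2 / 2)) w := fun w => by
    by_cases hw : w ∈ Set.Ici u
    · have hv : 0 ≤ u * (w - u) := mul_nonneg hu.le (sub_nonneg.2 hw)
      have hk := (smootherHat_pos (u * (w - u))).ne'
      rw [Set.indicator_of_mem hw, Set.indicator_of_mem (Set.mem_Ici.2 hv), expRatio_apply,
        tiltDensity, abs_of_nonneg hv, smul_eq_mul]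
      field_simp
      rw [← Real.exp_add]
      congr 1; ring
    · have hv : ¬ 0 ≤ u * (w - u) := fun h => hw (by
        have := nonneg_of_mul_nonneg_right h hu
        simpa using this)
      rw [Set.indicator_of_notMem hw, Set.indicator_of_notMem (by simpa using hv), smul_zero]
  simp_rw [e]
  rw [integral_indicator_const _ measurableSet_Ici, smul_eq_mul, mul_comm]

/-- Tail asymptotics from the behaviour of the Laplace transform in a complex neighbourhood. -/
theorem exists_tendsto_mul_exp_mul_tail : ∃ c : ℝ, 0 < c ∧
    ∀ (m : ℕ → Measure ℝ) [∀ n, IsProbabilityMeasure (m n)] (u : ℕ → ℝ) (_ : ∀ n, 0 < u n)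
      (_ : Tendsto u atTop atTop) (_ : ∀ n, Integrable (fun w => Real.exp (u n * w)) (m n))
      (_ : ∀ Θ : ℝ, ∀ ε > 0, ∀ᶠ n in atTop, ∀ θ : ℝ, |θ| ≤ Θ →
        ‖tiltFourier (m n) (u n) θ - (Real.exp (-(θ * u n) ^ 2 / 2) : ℂ)‖ ≤
          ε * Real.exp (-(θ * u n) ^ 2 / 2)),
      Tendsto (fun n => u n * Real.exp (u n ^ 2 / 2) * (m n).real (Set.Ici (u n))) atTop (𝓝 c) := by
  set G : ℝ := ∫ r : ℝ, Real.exp (-(2 * Real.pi * r) ^ 2 / 2) with hG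
  have hG0 : 0 < G := by
    have e : G = ∫ r : ℝ, Real.exp (-(2 * Real.pi ^ 2) * r ^ 2) := by
      rw [hG]; congr 1; funext r; congr 1; ring
    rw [e, integral_gaussian]
    positivity
  refine ⟨2 * G * ∫ x in Set.Ici 0, expRatio x ∂(smoothMeasure : Measure ℝ),
    mul_pos (by positivity) setIntegral_expRatio_pos, ?_⟩
  intro m _ u hu0 hu hint hT
  have hlim := tendsto_integral_smoother_mul hu
    (fun n => stronglyMeasurable_tiltFourier (m n) (u n)) hT
  rw [integral_complex_ofReal, ← hG] at hlim
  -- Frequency `t = 0` gives the asymptotics of the normalising constant.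
  have hc : Tendsto (fun n => u n * ∫ w, tiltDensity (u n) w ∂(m n)) atTop (𝓝 (2 * G)) := by
    have h1 := hlim 0
    have e : ∀ n, (u n : ℂ) * ∫ s, smoother s * tiltFourier (m n) (u n) (2 * Real.pi * (0 - s)) =
        ((u n * ∫ w, tiltDensity (u n) w ∂(m n) : ℝ) : ℂ) := fun n => by
      rw [← integral_smootherHat_tilt (hint n)]
      simp only [Complex.ofReal_zero, mul_zero, zero_mul, Complex.exp_zero, mul_one]
      rw [integral_complex_ofReal]
      push_cast
      rfl
    simp_rw [e, smoother_zero] at h1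
    have h2 := (Complex.continuous_re.tendsto _).comp h1
    refine (h2.congr fun n => ?_).trans (le_of_eq ?_)
    · simp only [Function.comp_apply, Complex.ofReal_re]
    · congr 1
      simp
  -- Dividing by the normalisation removes `G`, so the characteristic functions tend to `smoother t
  -- / 2`, that of `smoothMeasure`.
  have hw : Tendsto (fun n => tiltLaw (hint n)) atTop (𝓝 smoothMeasure) := by
    rw [ProbabilityMeasure.tendsto_iff_tendsto_charFun]
    intro t
    have ht : t = 2 * Real.pi * (t / (2 * Real.pi)) := by field_simp
    rw [ht]
    simp_rw [fun n => charFun_tiltLaw (hu0 n) (hint n)]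
    rw [charFun_smoothMeasure]
    have hcC := ((Complex.continuous_ofReal.tendsto _).comp hc).inv₀
      (by exact_mod_cast (by positivity : 2 * G ≠ 0))
    have h3 := hcC.mul (hlim (t / (2 * Real.pi)))
    refine h3.trans (le_of_eq ?_)
    congr 1
    have : (G : ℂ) ≠ 0 := by exact_mod_cast hG0.ne'
    push_cast
    field_simp
  have hfr : (smoothMeasure : Measure ℝ) (frontier (Set.Ici 0)) = 0 := by
    refine tilted_absolutelyContinuous _ _ ?_
    rw [frontier_Ici]; simp
  have h4 := hc.mul (tendsto_setIntegral_of_tendsto hw expRatio expRatio_pos measurableSet_Ici hfr)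
  refine h4.congr fun n => ?_
  have hpos : 0 < ∫ w, tiltDensity (u n) w ∂(m n) := by
    rw [integral_pos_iff_support_of_nonneg (fun w => (tiltDensity_pos _ w).le)
      (integrable_tiltDensity (hint n)), show Function.support (tiltDensity (u n)) = Set.univ from
      Set.eq_univ_of_forall fun x => (tiltDensity_pos _ x).ne']
    simp
  rw [setIntegral_expRatio_tiltLaw (hu0 n) (hint n)]
  field_simp

end Tail

/-! ### Verification of the tail criterion and comparison with the Gaussian law. -/

section Assembly

open Topology

lemma tiltFourier_eq (m : Measure ℝ) (u θ : ℝ) :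
    tiltFourier m u θ = Complex.exp (-(u ^ 2 / 2) - θ * u ^ 2 * Complex.I) *
      ∫ w : ℝ, Complex.exp ((u + θ * u * Complex.I) * w) ∂m := by
  rw [tiltFourier, ← integral_const_mul]
  congr 1; funext w
  rw [← Complex.exp_add]
  congr 1; push_cast; ring

lemma cexp_mul_cexp_sq (u θ : ℝ) :
    Complex.exp (-(u ^ 2 / 2) - θ * u ^ 2 * Complex.I) *
      Complex.exp ((u + θ * u * Complex.I) ^ 2 / 2) = (Real.exp (-(θ * u) ^ 2 / 2) : ℂ) := by
  rw [← Complex.exp_add, Complex.ofReal_exp]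
  congr 1
  push_cast
  linear_combination (θ : ℂ) ^ 2 * u ^ 2 / 2 * Complex.I_sq

/-- At `z = u + i θ u` the tilting prefactor turns `exp (z² / 2)` into `exp (-(θ u)² / 2)`, so a
relative error passes over unchanged. -/
lemma norm_tiltFourier_sub_le {m : Measure ℝ} {u θ ε : ℝ}
    (h : ‖∫ w : ℝ, Complex.exp ((u + θ * u * Complex.I) * w) ∂m -
      Complex.exp ((u + θ * u * Complex.I) ^ 2 / 2)‖ ≤
      ε * ‖Complex.exp ((u + θ * u * Complex.I) ^ 2 / 2)‖) :
    ‖tiltFourier m u θ - (Real.exp (-(θ * u) ^ 2 / 2) : ℂ)‖ ≤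
      ε * Real.exp (-(θ * u) ^ 2 / 2) := by
  have e : Real.exp (-(θ * u) ^ 2 / 2) = ‖Complex.exp (-(u ^ 2 / 2) - θ * u ^ 2 * Complex.I)‖ *
      ‖Complex.exp ((u + θ * u * Complex.I) ^ 2 / 2)‖ := by
    rw [← norm_mul, cexp_mul_cexp_sq, Complex.norm_real, Real.norm_of_nonneg (Real.exp_pos _).le]
  rw [← cexp_mul_cexp_sq, tiltFourier_eq, ← mul_sub, norm_mul, e, mul_left_comm]
  gcongr

lemma tiltFourier_gaussianReal (u θ : ℝ) :
    tiltFourier (gaussianReal 0 1) u θ = (Real.exp (-(θ * u) ^ 2 / 2) : ℂ) := by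
  have h := complexMGF_id_gaussianReal (μ := 0) (v := 1) (u + θ * u * Complex.I)
  rw [complexMGF] at h
  simp only [id_eq] at h
  rw [tiltFourier_eq, h, ← cexp_mul_cexp_sq]
  simp

lemma one_sub_cdf_gaussianReal (x : ℝ) :
    1 - cdf (gaussianReal 0 1) x = (gaussianReal 0 1).real (Set.Ici x) := by
  have : NullSingletonClass (gaussianReal 0 1) := nullSingletonClass_gaussianReal one_ne_zero
  rw [cdf_eq_real, ← probReal_compl_eq_one_sub measurableSet_Iic, Set.compl_Iic,
    measureReal_def, measureReal_def, measure_congr Ioi_ae_eq_Ici]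

theorem theorem1 {Ω : ℕ → Type*} [∀ n, MeasurableSpace (Ω n)] (μ : ∀ n, Measure (Ω n))
    [∀ n, IsProbabilityMeasure (μ n)]
    (X : ∀ n, Fin n → Fin n → Ω n → ℝ) (π : ∀ n, Ω n → Equiv.Perm (Fin n))
    (hmeas : ∀ n, 2 ≤ n → ∀ i j, Measurable (X n i j))
    (hmom : ∀ n, 2 ≤ n → ∀ i j, ∀ k : ℕ, Integrable (fun ω => X n i j ω ^ k) (μ n))
    (hindep : ∀ n, 2 ≤ n → iIndepFun (fun (p : Fin n × Fin n) => X n p.1 p.2) (μ n))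
    (hπ : ∀ n, 2 ≤ n → IsUniformPerm (π n) (μ n))
    (hπX : ∀ n, 2 ≤ n → IndepFun (π n) (fun ω i j => X n i j ω) (μ n))
    (hcol : ∀ n, 2 ≤ n → ∀ j, ∑ i, ∫ ω, X n i j ω ∂(μ n) = 0)
    (hrow : ∀ n, 2 ≤ n → ∀ i, ∑ j, ∫ ω, X n i j ω ∂(μ n) = 0)
    (M : ℕ → ℝ) (hMpos : ∀ n, 2 ≤ n → 0 < M n) (hMmono : MonotoneOn M (Set.Ici 2))
    (D : ℝ) (hD : 0 < D)
    (hbern : ∀ n, 2 ≤ n → ∀ i j, ∀ s ∈ ({1, 2, 3} : Set ℕ), ∀ k : ℕ, s ≤ k →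
      |∫ ω, X n i j ω ^ k ∂(μ n)| ≤
        D * (k ! : ℝ) * M n ^ (k - s) * ∫ ω, |X n i j ω| ^ s ∂(μ n))
    (u : ℕ → ℝ) (hupos : ∀ n, 2 ≤ n → 0 < u n) (hu : Tendsto u atTop atTop)
    (hu3 : (fun n => u n ^ 3) =o[atTop] (fun n => √(n : ℝ) / lyapGamma (X n) (μ n)))
    (huM : u =o[atTop] (fun n => √(normB (X n) (μ n)) / M n)) :
    (fun n => (μ n).real {ω | u n * √(normB (X n) (μ n)) ≤ combSum (X n) (π n) ω})
      ~[atTop] (fun n => 1 - cdf (gaussianReal 0 1) (u n)) := by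

  have hBern : ∀ n, 2 ≤ n → IsBernsteinArray (X n) (μ n) D (M n) := fun n hn =>
    ⟨hmeas n hn, hmom n hn, hcol n hn, hrow n hn, hD, hMpos n hn, hbern n hn⟩
  -- If the variance vanished, the comparison function in `huM` would be zero, contradicting `u n >
  -- 0`.
  have hB : ∀ᶠ n in atTop, 0 < normB (X n) (μ n) := by
    filter_upwards [huM.bound one_pos, eventually_ge_atTop 2] with n hn h2
    refine lt_of_le_of_ne normB_nonneg fun h => ?_
    rw [← h, Real.sqrt_zero, zero_div, norm_zero, mul_zero, Real.norm_of_nonneg (hupos n h2).le]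
      at hn
    exact absurd (hupos n h2) (not_lt.2 hn)
  have hKM : ∀ C : ℝ, 0 < C → ∀ᶠ n in atTop, C * u n * M n ≤ √(normB (X n) (μ n)) / 2 := by
    intro C hC
    filter_upwards [huM.bound (show 0 < 1 / (2 * C) by positivity), eventually_ge_atTop 2]
      with n hn h2
    have hM := hMpos n h2
    rw [Real.norm_of_nonneg (hupos n h2).le, Real.norm_of_nonneg (by positivity),
      div_mul_div_comm, one_mul, le_div_iff₀ (by positivity)] at hn
    linarith
  have hq : ∀ C : ℝ, Tendsto (fun n => (C * u n) ^ 3 * lyapGamma (X n) (μ n) / √(n : ℝ)) atTop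
      (𝓝 0) := by
    intro C
    have h := hu3.tendsto_div_nhds_zero.const_mul (C ^ 3)
    rw [mul_zero] at h
    refine h.congr fun n => ?_
    rw [div_div_eq_mul_div]; ring
  have hmgf : ∀ C : ℝ, 0 < C → ∀ ε > 0, ∀ᶠ n in atTop, ∀ z : ℂ, ‖z‖ ≤ C * u n →
      ‖∫ ω, Complex.exp (z * (combSum (X n) (π n) ω / √(normB (X n) (μ n)) : ℝ)) ∂(μ n) -
        Complex.exp (z ^ 2 / 2)‖ ≤ ε * ‖Complex.exp (z ^ 2 / 2)‖ := by
    intro C hC ε hε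
    have hDq : Tendsto (fun n => 2 * D * ((C * u n) ^ 3 * lyapGamma (X n) (μ n) / √(n : ℝ))) atTop
        (𝓝 0) := by simpa using (hq C).const_mul (2 * D)
    filter_upwards [hB, hKM C hC, eventually_ge_atTop 4,
      (hu.const_mul_atTop hC).eventually_ge_atTop 1, (hq C).eventually_le_const one_pos,
      hDq.eventually_le_const (show (0 : ℝ) < 1 / 100 by norm_num),
      ((tendsto_mgfError D).comp (hq C)).eventually_le_const hε] with n hBn hKMn hn hK hq1 hDq1 herr
    intro z hz
    have h2 : 2 ≤ n := by omega
    refine ((hBern n h2).norm_integral_cexp_combSum_sub_le hBn hKMn hz hn hK (hindep n h2)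
      (hπ n h2) (hπX n h2) rfl hq1 hDq1).trans ?_
    gcongr
    exact herr
  set W : ∀ n, Ω n → ℝ := fun n ω => combSum (X n) (π n) ω / √(normB (X n) (μ n)) with hW
  have hWm : ∀ n, 2 ≤ n → Measurable (W n) := fun n h2 =>
    (measurable_combSum (hmeas n h2) (hπ n h2).1).div_const _
  -- The tail criterion asks for its hypotheses at every index, while nondegeneracy holds only
  -- eventually; the sequences are shifted by `N`.
  obtain ⟨N, hN⟩ := eventually_atTop.1 (((hB.and (hKM 1 one_pos)).and (eventually_ge_atTop 2)))
  have hN2 : ∀ k, 2 ≤ k + N := fun k => (hN (k + N) (by omega)).2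
  have hNB : ∀ k, 0 < normB (X (k + N)) (μ (k + N)) := fun k => (hN (k + N) (by omega)).1.1
  have hu' : Tendsto (fun k => u (k + N)) atTop atTop := (tendsto_add_atTop_iff_nat N).2 hu
  have hu'0 : ∀ k, 0 < u (k + N) := fun k => hupos _ (hN2 k)
  obtain ⟨c, hc, hmain⟩ := exists_tendsto_mul_exp_mul_tail
  have hprob : ∀ k, IsProbabilityMeasure ((μ (k + N)).map (W (k + N))) := fun k =>
    Measure.isProbabilityMeasure_map (hWm _ (hN2 k)).aemeasurable
  have h1 := hmain (fun k => (μ (k + N)).map (W (k + N))) (fun k => u (k + N)) hu'0 hu' (by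
      intro k
      rw [integrable_map_measure (by fun_prop) (hWm _ (hN2 k)).aemeasurable]
      have hb := Real.sqrt_pos.2 (hNB k)
      have hz : ‖(u (k + N) : ℂ)‖ ≤ 1 * u (k + N) := by
        rw [Complex.norm_real, Real.norm_of_nonneg (hu'0 k).le, one_mul]
      have h := (integrable_cexp_combSum (hmeas _ (hN2 k)) (hindep _ (hN2 k)) (hπ _ (hN2 k)).1
        ((hBern _ (hN2 k)).integrable_exp_div (hNB k) (hN (k + N) (by omega)).1.2 hz)).norm
      refine h.congr (Eventually.of_forall fun ω => ?_)
      simp only [Function.comp_apply, hW]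
      rw [Complex.norm_exp]
      congr 1
      rw [← Complex.ofReal_div, ← Complex.ofReal_mul, Complex.ofReal_re]
      ring) (by
      intro Θ ε hε
      -- The point `u + i θ u` has modulus at most `(1 + |Θ|) u`.
      have h := hmgf (1 + |Θ|) (by positivity) ε hε
      filter_upwards [(tendsto_add_atTop_iff_nat N).2 tendsto_id |>.eventually h] with k hk
      intro θ hθ
      refine norm_tiltFourier_sub_le ?_
      rw [integral_map (hWm _ (hN2 k)).aemeasurable (by
        apply Continuous.aestronglyMeasurable; fun_prop)]
      refine hk _ ?_
      refine (norm_add_le _ _).trans ?_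
      rw [norm_mul, norm_mul, Complex.norm_I, mul_one, Complex.norm_real, Complex.norm_real,
        Real.norm_of_nonneg (hu'0 k).le, Real.norm_eq_abs, add_mul, one_mul]
      simp only [id_eq]
      have : |θ| ≤ |Θ| := hθ.trans (le_abs_self _)
      have := hu'0 k
      gcongr)
  -- For the Gaussian law the transform condition holds with zero error, so its tail has the same
  -- constant `c`.
  have h2 := hmain (fun _ => gaussianReal 0 1) (fun k => u (k + N)) hu'0 hu'
    (fun k => integrable_exp_mul_gaussianReal _) (by
      intro Θ ε hε
      refine Eventually.of_forall fun k θ _ => ?_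
      rw [tiltFourier_gaussianReal, sub_self, norm_zero]
      positivity)
  refine isEquivalent_of_tendsto_one ?_
  rw [← tendsto_add_atTop_iff_nat N]
  have h3 := h1.div h2 hc.ne'
  rw [div_self hc.ne'] at h3
  refine h3.congr fun k => ?_
  have hset : {ω | u (k + N) * √(normB (X (k + N)) (μ (k + N))) ≤
      combSum (X (k + N)) (π (k + N)) ω} = W (k + N) ⁻¹' Set.Ici (u (k + N)) := by
    ext ω
    simp only [hW, Set.mem_ofPred_eq, Set.mem_preimage, Set.mem_Ici]
    rw [le_div_iff₀ (Real.sqrt_pos.2 (hNB k))]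
  have hpos : u (k + N) * Real.exp (u (k + N) ^ 2 / 2) ≠ 0 :=
    mul_ne_zero (hu'0 k).ne' (Real.exp_pos _).ne'
  simp only [Pi.div_apply]
  rw [hset, one_sub_cdf_gaussianReal, map_measureReal_apply (hWm _ (hN2 k)) measurableSet_Ici,
    mul_div_mul_left _ _ hpos]

end Assembly
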